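/- Let $k$ be a field of characteristic zero. A variety over $k$ is a reduced separated scheme of finite type over $k$. Let $K_0(\mathrm{Var}/k)$ be the Grothendieck ring of varieties over $k$: the commutative ring generated by the isomorphism classes $[X]$ of varieties $X$ over $k$, subject to the relations $[X]=[Z]+[U]$ whenever $Z\subset X$ is a closed subvariety with open complement $U$, with product given by $[X][Y]=[X\times_k Y]$ and unit $1=[\operatorname{Spec} k]$. Put $\mathbb L=[\mathbb A^1_k]$. Two varieties $X,Y$ are called L-equivalent if $[X]-[Y]$ vanishes in the localization $K_0(\mathrm{Var}/k)[\mathbb L^{-1}]$. For an ordered $8$-tuple $\mathbf p=(p_1,\dots,p_8)$ of distinct $k$-rational points of $\mathbb P^3_k$, let $X_{\mathbf p}$ be the blow-up of $\mathbb P^3_k$ along the reduced closed subscheme $\{p_1,\dots,p_8\}$. Then $X_{\mathbf p}$ is a variety over $k$ and $$[X_{\mathbf p}]=\mathbb L^3+9\,\mathbb L^2+9\,\mathbb L+1\quad\text{in } K_0(\mathrm{Var}/k).$$ In particular the class does not depend on $\mathbf p$: for any two such $8$-tuples $\mathbf p,\mathbf q$ one has $[X_{\mathbf p}]=[X_{\mathbf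 q}]$, and $X_{\mathbf p}$ and $X_{\mathbf q}$ are L-equivalent. (This applies in particular to every pair of non-isomorphic, derived equivalent $X_{\mathbf p}$, $X_{\mathbf q}$, such as those in Lesieutre's infinite family, and so confirms the Kuznetsov–Shinder conjecture, that derived equivalent simply connected smooth projective varieties are L-equivalent, for these pairs.) -/

import Mathlib

open CategoryTheory CategoryTheory.Limits AlgebraicGeometry

universe u

noncomputable section

/-- A variety over `k`: a reduced separated scheme of finite type over `k` (it may be reducible
or empty). -/
structure IsVariety {k : Type u} [Field k] (X : Over (Spec (.of k))) : Prop where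
  isReduced : IsReduced X.left
  isSeparated : IsSeparated X.hom
  locallyOfFiniteType : LocallyOfFiniteType X.hom
  quasiCompact : QuasiCompact X.hom

/-- The type of all varieties over `k`. -/
structure Variety (k : Type u) [Field k] : Type (u + 1) where
  toOver : Over (Spec (.of k))
  isVariety : IsVariety toOver

/-- The defining relations of the Grothendieck ring of varieties, between elements of the free
commutative ring on all varieties over `k`. (A product of varieties over a field of characteristic
zero is reduced, so that the relation `prod` applies to every pair of varieties.) -/
inductive K0Rel (k : Type u) [Field k] :
    FreeCommRing (Variety k) → FreeCommRing (Variety k) → Prop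
  /-- Isomorphic varieties have the same class. -/
  | iso (X Y : Variety k) (e : X.toOver ≅ Y.toOver) : K0Rel k (.of X) (.of Y)
  /-- `[X] = [Z] + [U]` for `Z` a closed subvariety of `X` with open complement `U`. -/
  | scissor (X Z U : Variety k) (i : Z.toOver ⟶ X.toOver) (j : U.toOver ⟶ X.toOver)
      (hi : IsClosedImmersion i.left) (hj : IsOpenImmersion j.left)
      (h : IsCompl (Set.range i.left) (Set.range j.left)) :
      K0Rel k (.of X) (.of Z + .of U)
  /-- `[X ×ₖ Y] = [X] [Y]`. -/
  | prod (X Y P : Variety k) (fst : P.toOver ⟶ X.toOver) (snd : P.toOver ⟶ Y.toOver)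
      (h : IsPullback fst.left snd.left X.toOver.hom Y.toOver.hom) :
      K0Rel k (.of P) (.of X * .of Y)
  /-- `[Spec k] = 1`. -/
  | point (X : Variety k) (h : IsIso X.toOver.hom) : K0Rel k (.of X) 1

/-- The Grothendieck ring of varieties `K₀(Var/k)`. -/
abbrev K0Var (k : Type u) [Field k] : Type (u + 1) :=
  FreeCommRing (Variety k) ⧸ Ideal.ofRel (K0Rel k)

/-- The class `[X]` in `K₀(Var/k)`. -/
def K0Var.cls {k : Type u} [Field k] (X : Variety k) : K0Var k :=
  Ideal.Quotient.mk _ (FreeCommRing.of X)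

/-- The affine line `Spec k[t]` over `k`. -/
def affineLine (k : Type u) [Field k] : Variety k where
  toOver := Over.mk (Spec.map (CommRingCat.ofHom (algebraMap k (Polynomial k))))
  isVariety := by
    refine ⟨?_, ?_, ?_, ?_⟩
    · dsimp; infer_instance
    · dsimp; infer_instance
    · refine (HasRingHomProperty.Spec_iff (P := @LocallyOfFiniteType)).mpr ?_
      exact RingHom.finiteType_algebraMap.mpr inferInstance
    · dsimp; infer_instance

/-- The Lefschetz class `𝕃 = [𝔸¹]`. -/
def lefschetz (k : Type u) [Field k] : K0Var k := K0Var.cls (affineLine k)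

/-- `X` and `Y` are L-equivalent: `[X]` and `[Y]` agree in `K₀(Var/k)[𝕃⁻¹]`. -/
def LEquivalent {k : Type u} [Field k] (X Y : Variety k) : Prop :=
  algebraMap (K0Var k) (Localization.Away (lefschetz k)) (K0Var.cls X - K0Var.cls Y) = 0

attribute [local instance] MvPolynomial.gradedAlgebra in
/-- Projective 3-space over `k`: `Proj k[x₀, x₁, x₂, x₃]` with its structure morphism. -/
def projectiveThreeSpace (k : Type u) [Field k] : Over (Spec (.of k)) :=
  Over.mk (Y := Proj (MvPolynomial.homogeneousSubmodule (Fin 4) k))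
    (Proj.toSpecZero (MvPolynomial.homogeneousSubmodule (Fin 4) k) ≫
      Spec.map (CommRingCat.ofHom
        (algebraMap k (MvPolynomial.homogeneousSubmodule (Fin 4) k 0))))

/-- The `k`-rational points of a `k`-scheme: sections of its structure morphism. -/
abbrev RationalPoint {k : Type u} [Field k] (X : Over (Spec (.of k))) : Type u :=
  Over.mk (𝟙 (Spec (.of k))) ⟶ X

/-- The ideal sheaf of the closed subscheme formed by a family of rational points: the functions
that vanish at each of the points. -/
def idealOfPoints {k : Type u} [Field k] {X : Over (Spec (.of k))} {n : ℕ}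
    (p : Fin n → RationalPoint X) : X.left.IdealSheafData :=
  ⨅ i, (p i).left.ker

/-- An ideal sheaf is invertible (the closed subscheme is an effective Cartier divisor) if locally
it is generated by one element that is not a zero divisor. -/
def IsInvertibleIdeal {X : Scheme.{u}} (I : X.IdealSheafData) : Prop :=
  ∀ x : X, ∃ U : X.affineOpens, x ∈ U.1 ∧
    ∃ a ∈ nonZeroDivisors Γ(X, U.1), I.ideal U = Ideal.span {a}

/-- `π : X ⟶ Y` is the blow-up of `Y` along the closed subscheme with ideal sheaf `I`: the inverse
image ideal sheaf `π⁻¹I · 𝒪_X` is invertible, and `π` is universal (terminal) among the morphisms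
to `Y` with this property. -/
structure IsBlowUp {X Y : Scheme.{u}} (π : X ⟶ Y) (I : Y.IdealSheafData) : Prop where
  invertible : IsInvertibleIdeal (I.comap π)
  existsUnique_lift (T : Scheme.{u}) (f : T ⟶ Y) (hf : IsInvertibleIdeal (I.comap f)) :
    ∃! g : T ⟶ X, g ≫ π = f

end

/-! Blowing up a rational point of a smooth threefold replaces the point by a copy of `ℙ²` and
changes nothing elsewhere. Cutting along the exceptional fibres gives `[X] = [ℙ³] - 8 + 8[ℙ²]`, and
`[ℙ³] = 𝕃³ + 𝕃² + 𝕃 + 1`, `[ℙ²] = 𝕃² + 𝕃 + 1` turn this into the formula. The positions of the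
points never enter, and equality in `K₀` passes to every localization.

The blow-up is known only through its universal property, so its geometry has to be derived from
that. Over affine space the candidate charts are the substitutions `X l ↦ X i * X l`. A morphism
whose inverse image ideal is invertible factors through chart `i` exactly where the pull-back of `X
i` generates that ideal (`IsGeneratedAt`), and it does so uniquely because `X i` pulls back to a non
zero divisor. Hence the charts are open immersions (`isOpenImmersion_chart`), cover the blow-up, and
meet where a coordinate is nonzero (`chart_mem_range_chart_iff`). Separatedness follows by the
valuative criterion, the remaining properties of a variety by gluing.

The class is computed by filtrations through open subsets whose successive differences are affine
spaces (`cls_restrict_eq_add`). Projective space is filtered by the first nonvanishing homogeneous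
coordinate. The exceptional fibre is treated in the same way: its `i`-th cell consists of the
exceptional points of chart `i` that lie in no earlier chart. Every rational point of projective
space is the origin of a translated standard chart (`nonempty_pointChart`), so the local computation
applies at each of the points, and `cls_add_eq` assembles the count. -/

noncomputable section

/-! ### Ideal sheaves on affine schemes; invertibility tested in affine charts -/

/-- The ideal sheaf on `Spec R` attached to an ideal of `R`. -/
def specIdeal {R : CommRingCat.{u}} (J : Ideal R) : (Spec R).IdealSheafData :=
  .ofIdealTop (J.comap (Scheme.ΓSpecIso R).hom.hom)

lemma ideal_top_specIdeal {R : CommRingCat.{u}} (J : Ideal R) :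
    (specIdeal J).ideal ⟨⊤, isAffineOpen_top _⟩ = J.comap (Scheme.ΓSpecIso R).hom.hom :=
  Scheme.IdealSheafData.equivOfIsAffine.right_inv _

lemma specIdeal_le_iff {R : CommRingCat.{u}} {J K : Ideal R} :
    specIdeal J ≤ specIdeal K ↔ J ≤ K := by
  constructor
  · intro h
    have := h ⟨⊤, isAffineOpen_top _⟩
    rw [ideal_top_specIdeal, ideal_top_specIdeal] at this
    exact (Ideal.comap_le_comap_iff_of_surjective _
      (ConcreteCategory.bijective_of_isIso (Scheme.ΓSpecIso R).hom).2 _ _).mp this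
  · intro h
    apply Scheme.IdealSheafData.le_of_isAffine
    rw [ideal_top_specIdeal, ideal_top_specIdeal]
    exact Ideal.comap_mono h

lemma specIdeal_injective {R : CommRingCat.{u}} : Function.Injective (specIdeal (R := R)) :=
  fun _ _ h ↦ le_antisymm (specIdeal_le_iff.mp h.le) (specIdeal_le_iff.mp h.ge)

lemma specIdeal_surjective {R : CommRingCat.{u}} : Function.Surjective (specIdeal (R := R)) := by
  intro I
  refine ⟨(I.ideal ⟨⊤, isAffineOpen_top _⟩).comap (Scheme.ΓSpecIso R).inv.hom, ?_⟩
  apply Scheme.IdealSheafData.ext_of_isAffine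
  rw [ideal_top_specIdeal, Ideal.comap_comap, ← CommRingCat.hom_comp, Iso.hom_inv_id]
  exact Ideal.comap_id _

lemma ker_specMap {R S : CommRingCat.{u}} (φ : R ⟶ S) :
    (Spec.map φ).ker = specIdeal (RingHom.ker φ.hom) := by
  rw [Scheme.ker_of_isAffine, specIdeal]
  congr 1
  rw [RingHom.comap_ker, ← CommRingCat.hom_comp, ← Scheme.ΓSpecIso_naturality,
    CommRingCat.hom_comp]
  exact (RingHom.ker_comp_of_injective _
    (ConcreteCategory.bijective_of_isIso (Scheme.ΓSpecIso S).hom).1).symm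

/-- Every ideal is the kernel of its quotient map, so its direct image is the kernel of a composite.
-/
lemma specIdeal_map {R S : CommRingCat.{u}} (φ : R ⟶ S) (K : Ideal S) :
    (specIdeal K).map (Spec.map φ) = specIdeal (K.comap φ.hom) := by
  have h : specIdeal K = (Spec.map (CommRingCat.ofHom (Ideal.Quotient.mk K))).ker := by
    rw [ker_specMap, CommRingCat.hom_ofHom, Ideal.mk_ker]
  rw [h, Scheme.IdealSheafData.map_ker, ← Spec.map_comp, ker_specMap, CommRingCat.hom_comp,
    ← RingHom.comap_ker, CommRingCat.hom_ofHom, Ideal.mk_ker]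

/-- Inverse image of ideal sheaves is left adjoint to direct image, and extension of ideals is left
adjoint to contraction. The right adjoints agree, hence so do the left ones. -/
lemma specIdeal_comap {R S : CommRingCat.{u}} (φ : R ⟶ S) (J : Ideal R) :
    (specIdeal J).comap (Spec.map φ) = specIdeal (J.map φ.hom) := by
  have key (K : Ideal S) : (specIdeal J).comap (Spec.map φ) ≤ specIdeal K ↔
      specIdeal (J.map φ.hom) ≤ specIdeal K := by
    rw [← Scheme.IdealSheafData.le_map_iff_comap_le, specIdeal_map, specIdeal_le_iff,
      specIdeal_le_iff, Ideal.map_le_iff_le_comap]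
  apply le_antisymm
  · exact (key _).mpr le_rfl
  · obtain ⟨K, hK⟩ := specIdeal_surjective ((specIdeal J).comap (Spec.map φ))
    rw [← hK]
    exact (key K).mp hK.ge

lemma comap_eq_specIdeal {X : Scheme.{u}} (I : X.IdealSheafData) {R : CommRingCat.{u}}
    (j : Spec R ⟶ X) [IsOpenImmersion j] (U : X.affineOpens) (h : j ''ᵁ ⊤ ≤ U.1) :
    I.comap j = specIdeal ((I.ideal U).map
      (X.presheaf.map (homOfLE h).op ≫ (j.appIso ⊤).hom ≫ (Scheme.ΓSpecIso R).hom).hom) := by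
  apply Scheme.IdealSheafData.ext_of_isAffine
  rw [ideal_top_specIdeal, Scheme.IdealSheafData.ideal_comap_of_isOpenImmersion]
  rw [← I.map_ideal (U := ⟨j ''ᵁ ⊤, (isAffineOpen_top _).image_of_isOpenImmersion j⟩) (V := U) h]
  rw [CommRingCat.hom_comp, ← Ideal.map_map, CommRingCat.hom_comp, ← Ideal.map_map]
  have e1 := Ideal.comap_symm (I := Ideal.map (X.presheaf.map (homOfLE h).op).hom (I.ideal U))
    (j.appIso ⊤).commRingCatIsoToRingEquiv
  have e2 := Ideal.map_symm (I := Ideal.map (j.appIso ⊤).hom.hom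
      (Ideal.map (X.presheaf.map (homOfLE h).op).hom (I.ideal U)))
    (Scheme.ΓSpecIso R).commRingCatIsoToRingEquiv.symm
  erw [e2, e1]
  exact (Ideal.comap_of_equiv (Scheme.ΓSpecIso R).commRingCatIsoToRingEquiv).symm

/-- Replaces affine opens by arbitrary open immersions from spectra, so that invertibility can be
handled by ring homomorphisms. -/
lemma isInvertibleIdeal_iff {X : Scheme.{u}} (I : X.IdealSheafData) :
    IsInvertibleIdeal I ↔ ∀ x : X, ∃ (R : CommRingCat.{u}) (j : Spec R ⟶ X)
      (_ : IsOpenImmersion j), x ∈ Set.range j ∧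
      ∃ a ∈ nonZeroDivisors R, I.comap j = specIdeal (Ideal.span {a}) := by
  constructor
  · intro h x
    obtain ⟨⟨U, hU'⟩, hxU, a, ha, e⟩ := h x
    replace hU' : IsAffineOpen U := hU'
    have hU : hU'.fromSpec ''ᵁ ⊤ ≤ U := by
      rw [Scheme.Hom.image_top_eq_opensRange, hU'.opensRange_fromSpec]
    refine ⟨Γ(X, U), hU'.fromSpec, inferInstance, ?_,
      (X.presheaf.map (homOfLE hU).op ≫ (hU'.fromSpec.appIso ⊤).hom ≫
        (Scheme.ΓSpecIso _).hom).hom a, ?_,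
      (comap_eq_specIdeal I hU'.fromSpec ⟨U, hU'⟩ hU).trans ?_⟩
    · rw [hU'.range_fromSpec]; exact hxU
    · have hUe : U = hU'.fromSpec ''ᵁ ⊤ := by
        rw [Scheme.Hom.image_top_eq_opensRange, hU'.opensRange_fromSpec]
      have : IsIso (X.presheaf.map (homOfLE hU).op) := by
        have : IsIso (homOfLE hU) := ⟨homOfLE hUe.le, rfl, rfl⟩
        infer_instance
      exact (MulEquivClass.map_nonZeroDivisors ((asIso (X.presheaf.map (homOfLE hU).op)) ≪≫
        (hU'.fromSpec.appIso ⊤) ≪≫ (Scheme.ΓSpecIso _)).commRingCatIsoToRingEquiv) ▸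
          Submonoid.mem_map_of_mem _ ha
    · rw [e, Ideal.map_span, Set.image_singleton]
  · intro h x
    obtain ⟨R, j, hj, hx, a, ha, e⟩ := h x
    have hjt : IsAffineOpen (j ''ᵁ ⊤) := (isAffineOpen_top _).image_of_isOpenImmersion j
    rw [comap_eq_specIdeal I j ⟨_, hjt⟩ le_rfl] at e
    replace e := specIdeal_injective e
    let E : Γ(X, j ''ᵁ ⊤) ≃+* R :=
      ((j.appIso ⊤) ≪≫ (Scheme.ΓSpecIso R)).commRingCatIsoToRingEquiv
    refine ⟨⟨_, hjt⟩, ?_, E.symm a, ?_, ?_⟩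
    · exact (show x ∈ j ''ᵁ ⊤ by rw [Scheme.Hom.image_top_eq_opensRange]; exact hx)
    · exact (MulEquivClass.map_nonZeroDivisors E.symm) ▸ Submonoid.mem_map_of_mem _ ha
    · have h2 : Ideal.map (E : Γ(X, j ''ᵁ ⊤) →+* R) (I.ideal ⟨_, hjt⟩) = Ideal.span {a} := by
        rw [← e]
        congr 1
        ext x
        simp [E]
      have h3 := congrArg (Ideal.map (E.symm : R →+* Γ(X, j ''ᵁ ⊤))) h2
      rw [Ideal.map_map, Ideal.map_span, Set.image_singleton] at h3
      simpa using h3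

/-- A morphism lifts, locally around a point of the source, to a map of affine charts. -/
lemma exists_specMap_comp_eq {T X : Scheme.{u}} (g : T ⟶ X) {R : CommRingCat.{u}}
    (j : Spec R ⟶ X) [IsOpenImmersion j] (O : T.Opens) (t : T) (htO : t ∈ O)
    (ht : g t ∈ Set.range j) :
    ∃ (S : CommRingCat.{u}) (i : Spec S ⟶ T) (_ : IsOpenImmersion i) (φ : R ⟶ S),
      t ∈ Set.range i ∧ Set.range i ⊆ O ∧ i ≫ g = Spec.map φ ≫ j := by
  obtain ⟨U, hU, htU, hUO⟩ := TopologicalSpace.Opens.isBasis_iff_nbhd.mp T.isBasis_affineOpens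
    (show t ∈ O ⊓ g ⁻¹ᵁ j.opensRange from ⟨htO, ht⟩)
  have hU' : IsAffineOpen U := hU
  have hr : Set.range (hU'.fromSpec ≫ g) ⊆ Set.range j := by
    rintro _ ⟨y, rfl⟩
    have : hU'.fromSpec y ∈ U := by
      rw [← SetLike.mem_coe, ← hU'.range_fromSpec]; exact ⟨y, rfl⟩
    rw [Scheme.Hom.comp_apply]
    exact (hUO this).2
  refine ⟨_, hU'.fromSpec, inferInstance, Spec.preimage (IsOpenImmersion.lift j _ hr), ?_, ?_, ?_⟩
  · rw [hU'.range_fromSpec]; exact htU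
  · rw [hU'.range_fromSpec]; exact fun x hx ↦ (hUO hx).1
  · rw [Spec.map_preimage, IsOpenImmersion.lift_fac]

/-- Open immersions are flat, and flat base change keeps multiplication by `a` injective. -/
lemma mem_nonZeroDivisors_of_isOpenImmersion {R S : CommRingCat.{u}} (φ : R ⟶ S)
    [IsOpenImmersion (Spec.map φ)] {a : R} (ha : a ∈ nonZeroDivisors R) :
    φ.hom a ∈ nonZeroDivisors S := by
  have h : φ.hom.Flat := Flat.SpecMap_iff.mp inferInstance
  algebraize [φ.hom]
  rw [mem_nonZeroDivisors_iff_right]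
  intro x hx
  have := Module.Flat.isSMulRegular_of_nonZeroDivisors (M := S) ha
  apply this
  simp only [smul_zero]
  rw [Algebra.smul_def, mul_comm]
  exact hx

lemma IsInvertibleIdeal.comap_of_isOpenImmersion {T X : Scheme.{u}} {I : X.IdealSheafData}
    (h : IsInvertibleIdeal I) (g : T ⟶ X) [IsOpenImmersion g] : IsInvertibleIdeal (I.comap g) := by
  rw [isInvertibleIdeal_iff] at h ⊢
  intro t
  obtain ⟨R, j, hj, ht, a, ha, e⟩ := h (g t)
  obtain ⟨S, i, hi, φ, hti, -, hφ⟩ := exists_specMap_comp_eq g j ⊤ t trivial ht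
  have : IsOpenImmersion (Spec.map φ ≫ j) := by rw [← hφ]; infer_instance
  have : IsOpenImmersion (Spec.map φ) := .of_comp _ j
  refine ⟨S, i, hi, hti, φ.hom a, mem_nonZeroDivisors_of_isOpenImmersion φ ha, ?_⟩
  rw [← Scheme.IdealSheafData.comap_comp, hφ, Scheme.IdealSheafData.comap_comp, e,
    specIdeal_comap, Ideal.map_span, Set.image_singleton]

lemma isInvertibleIdeal_top {X : Scheme.{u}} : IsInvertibleIdeal (⊤ : X.IdealSheafData) := by
  intro x
  obtain ⟨U, hU, hx, -⟩ := TopologicalSpace.Opens.isBasis_iff_nbhd.mp X.isBasis_affineOpens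
    (show x ∈ (⊤ : X.Opens) from trivial)
  exact ⟨⟨U, hU⟩, hx, 1, one_mem _, by simp⟩

end

/-! ### Which coordinate generates the inverse image ideal near a point -/

noncomputable section

/-- Common affine refinement of a chart of the source and a chart of the target of a morphism. -/
lemma exists_specMap_comp_eq_of_chart {T X : Scheme.{u}} (g : T ⟶ X) {R R' : CommRingCat.{u}}
    (j : Spec R ⟶ X) [IsOpenImmersion j] (j' : Spec R' ⟶ T) [IsOpenImmersion j'] (t : T)
    (ht' : t ∈ Set.range j') (ht : g t ∈ Set.range j) :
    ∃ (S : CommRingCat.{u}) (i : Spec S ⟶ T) (_ : IsOpenImmersion i) (φ : R ⟶ S) (ψ : R' ⟶ S),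
      IsOpenImmersion (Spec.map ψ) ∧
      t ∈ Set.range i ∧ i ≫ g = Spec.map φ ≫ j ∧ i = Spec.map ψ ≫ j' := by
  obtain ⟨S, i, hi, φ, hti, hr, e⟩ := exists_specMap_comp_eq g j j'.opensRange t ht' ht
  replace hr : Set.range i ⊆ Set.range j' := hr
  have e' : i = Spec.map (Spec.preimage (IsOpenImmersion.lift j' i hr)) ≫ j' := by
    rw [Spec.map_preimage, IsOpenImmersion.lift_fac]
  have : IsOpenImmersion (Spec.map (Spec.preimage (IsOpenImmersion.lift j' i hr)) ≫ j') := by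
    rw [← e']; exact hi
  exact ⟨S, i, hi, φ, _, .of_comp _ j', hti, e, e'⟩

variable {σ : Type} {A : CommRingCat.{u}}

/-- Near `t`, the pull-back of `x i` along `f` is a non zero divisor that divides the pull-back of
every `x l`. -/
def IsGeneratedAt (x : σ → A) {T : Scheme.{u}} (f : T ⟶ Spec A) (i : σ) (t : T) : Prop :=
  ∃ (R : CommRingCat.{u}) (j : Spec R ⟶ T) (_ : IsOpenImmersion j) (φ : A ⟶ R),
    t ∈ Set.range j ∧ j ≫ f = Spec.map φ ∧ φ.hom (x i) ∈ nonZeroDivisors R ∧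
      ∀ l, φ.hom (x i) ∣ φ.hom (x l)

/-- A Nakayama-type argument: if every quotient `y i / a` lay in `q`, then `a ∈ a q`, and cancelling
the non zero divisor `a` would give `1 ∈ q`. -/
lemma exists_notMem_of_span_eq_span_singleton {R : Type*} [CommRing R] {y : σ → R} {a : R}
    (h : Ideal.span (Set.range y) = Ideal.span {a}) (ha : a ∈ nonZeroDivisors R)
    (q : Ideal R) [hq : q.IsPrime] : ∃ (i : σ) (d : R), d ∉ q ∧ y i = a * d := by
  by_contra! hcon
  have hy (i : σ) : ∃ d, y i = a * d := by
    have : y i ∈ Ideal.span {a} := h ▸ Ideal.subset_span ⟨i, rfl⟩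
    obtain ⟨d, hd⟩ := Ideal.mem_span_singleton.mp this
    exact ⟨d, hd⟩
  choose d hd using hy
  have hle : Ideal.span (Set.range y) ≤ Ideal.span {a} * q := by
    rw [Ideal.span_le]
    rintro _ ⟨i, rfl⟩
    have hdq : d i ∈ q := by_contra fun hn ↦ hcon i (d i) hn (hd i)
    rw [hd i]
    exact Ideal.mul_mem_mul (Ideal.mem_span_singleton_self a) hdq
  have : a ∈ Ideal.span {a} * q := hle (h ▸ Ideal.mem_span_singleton_self a)
  obtain ⟨s, hs, e⟩ := Ideal.mem_span_singleton_mul.mp this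
  have h1 : s = 1 := by
    have : (s - 1) * a = 0 := by linear_combination e
    exact sub_eq_zero.mp ((mem_nonZeroDivisors_iff_right.mp ha) _ this)
  exact hq.ne_top ((Ideal.eq_top_iff_one q).mpr (h1 ▸ hs))

/-- After inverting `d`, the elements `x i = a * d` and `a` are associates, so `x i` inherits from
`a` both the divisibility and the non zero divisor property. -/
lemma IsGeneratedAt.of_notMem {x : σ → A} {T : Scheme.{u}} {f : T ⟶ Spec A} {R : CommRingCat.{u}}
    (j : Spec R ⟶ T) [IsOpenImmersion j] (φ : A ⟶ R) (e : j ≫ f = Spec.map φ)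
    (q : Spec R) (i : σ) (a d : R) (hd : d ∉ q.asIdeal)
    (h : φ.hom (x i) = a * d) (ha : a ∈ nonZeroDivisors R) (h' : ∀ l, a ∣ φ.hom (x l)) :
    IsGeneratedAt x f i (j q) := by
  let S : CommRingCat.{u} := .of (Localization.Away d)
  let ψ : R ⟶ S := CommRingCat.ofHom (algebraMap R (Localization.Away d))
  have hψ : IsOpenImmersion (Spec.map ψ) := inferInstanceAs
    (IsOpenImmersion (Spec.map (CommRingCat.ofHom (algebraMap R (Localization.Away d)))))
  have hu : IsUnit (ψ.hom d) := IsLocalization.Away.algebraMap_isUnit d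
  have hq : q ∈ Set.range (Spec.map ψ) := by
    have := PrimeSpectrum.localization_away_comap_range (Localization.Away d) d
    change q ∈ Set.range (PrimeSpectrum.comap (algebraMap R (Localization.Away d)))
    rw [this]
    exact hd
  obtain ⟨q', rfl⟩ := hq
  refine ⟨S, Spec.map ψ ≫ j, inferInstance, φ ≫ ψ, ⟨q', rfl⟩, ?_, ?_, fun l ↦ ?_⟩
  · rw [Category.assoc, e, Spec.map_comp]
  · rw [CommRingCat.hom_comp, RingHom.comp_apply, h, map_mul]
    exact mul_mem (mem_nonZeroDivisors_of_isOpenImmersion ψ ha) hu.mem_nonZeroDivisors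
  · rw [CommRingCat.hom_comp, RingHom.comp_apply, RingHom.comp_apply, h, map_mul]
    exact (hu.mul_right_dvd).mpr (map_dvd ψ.hom (h' l))

lemma exists_isGeneratedAt (x : σ → A) {T : Scheme.{u}} (f : T ⟶ Spec A)
    (h : IsInvertibleIdeal ((specIdeal (Ideal.span (Set.range x))).comap f)) (t : T) :
    ∃ i, IsGeneratedAt x f i t := by
  obtain ⟨R, j, hj, ⟨q, rfl⟩, a, ha, e⟩ := (isInvertibleIdeal_iff _).mp h t
  obtain ⟨φ, hφ⟩ := Spec.map_surjective (j ≫ f)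
  rw [← Scheme.IdealSheafData.comap_comp, ← hφ, specIdeal_comap] at e
  replace e := specIdeal_injective e
  rw [Ideal.map_span, ← Set.range_comp] at e
  have : q.asIdeal.IsPrime := PrimeSpectrum.isPrime q
  obtain ⟨i, d, hd, hi⟩ := exists_notMem_of_span_eq_span_singleton e ha q.asIdeal
  refine ⟨i, .of_notMem j φ hφ.symm q i a d hd hi ha fun l ↦ ?_⟩
  exact Ideal.mem_span_singleton.mp (e ▸ Ideal.subset_span ⟨l, rfl⟩)

lemma isInvertibleIdeal_of_isGeneratedAt (x : σ → A) {T : Scheme.{u}} (f : T ⟶ Spec A)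
    (h : ∀ t, ∃ i, IsGeneratedAt x f i t) :
    IsInvertibleIdeal ((specIdeal (Ideal.span (Set.range x))).comap f) := by
  rw [isInvertibleIdeal_iff]
  intro t
  obtain ⟨i, R, j, hj, φ, ht, e, hi, hl⟩ := h t
  refine ⟨R, j, hj, ht, _, hi, ?_⟩
  rw [← Scheme.IdealSheafData.comap_comp, e, specIdeal_comap, Ideal.map_span, ← Set.range_comp]
  congr 1
  apply le_antisymm
  · rw [Ideal.span_le]
    rintro _ ⟨l, rfl⟩
    exact Ideal.mem_span_singleton.mpr (hl l)
  · exact Ideal.span_mono (by rintro _ rfl; exact ⟨i, rfl⟩)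

/-- Divisibility survives pull-back, but being a non zero divisor need not. It is recovered from the
invertibility of the pulled-back ideal: near `t` some `x l` pulls back to a non zero divisor, and `x
i` divides it. -/
lemma IsGeneratedAt.comp {x : σ → A} {T T' : Scheme.{u}} {f : T ⟶ Spec A} (g : T' ⟶ T) {i : σ}
    {t : T'} (h : IsGeneratedAt x f i (g t))
    (hf : IsInvertibleIdeal ((specIdeal (Ideal.span (Set.range x))).comap (g ≫ f))) :
    IsGeneratedAt x (g ≫ f) i t := by
  obtain ⟨l, R', j', hj', φ', ht', e', hn', hl'⟩ := exists_isGeneratedAt x _ hf t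
  obtain ⟨R, j, hj, φ, ht, e, hn, hl⟩ := h
  obtain ⟨S, s, hs, α, β, hβ, hts, h1, h2⟩ := exists_specMap_comp_eq_of_chart g j j' t ht' ht
  have e1 : s ≫ g ≫ f = Spec.map (φ ≫ α) := by
    rw [reassoc_of% h1, e, Spec.map_comp]
  have e2 : φ ≫ α = φ' ≫ β := by
    apply Spec.map_injective
    rw [← e1, h2, Category.assoc, e', Spec.map_comp]
  refine ⟨S, s, hs, φ ≫ α, hts, e1, ?_, fun m ↦ ?_⟩
  · have hnl : (φ' ≫ β).hom (x l) ∈ nonZeroDivisors S :=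
      mem_nonZeroDivisors_of_isOpenImmersion β hn'
    have hd : (φ ≫ α).hom (x i) ∣ (φ' ≫ β).hom (x l) := by
      rw [← e2]; exact map_dvd α.hom (hl l)
    obtain ⟨c, hc⟩ := hd
    rw [hc] at hnl
    exact (mul_mem_nonZeroDivisors.mp hnl).1
  · exact map_dvd α.hom (hl m)

/-- Near `g t` the ideal is generated by some `x l`, with `x i = x l * d`. Upstairs `x i` divides `x
l` as well, so `d` pulls back to a unit; thus `d` does not vanish at `g t`, and inverting it makes
`x i` a generator there. -/
lemma IsGeneratedAt.of_comp {x : σ → A} {T T' : Scheme.{u}} {f : T ⟶ Spec A} (g : T' ⟶ T) {i : σ}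
    {t : T'} (h : IsGeneratedAt x (g ≫ f) i t)
    (hf : IsInvertibleIdeal ((specIdeal (Ideal.span (Set.range x))).comap f)) :
    IsGeneratedAt x f i (g t) := by
  obtain ⟨l, R, j, hj, φ, ⟨q, hq⟩, e, hn, hl⟩ := exists_isGeneratedAt x _ hf (g t)
  obtain ⟨R', j', hj', φ', ht', e', hn', hl'⟩ := h
  obtain ⟨S, s, hs, α, β, hβ, ⟨r, hr⟩, h1, h2⟩ :=
    exists_specMap_comp_eq_of_chart g j j' t ht' ⟨q, hq⟩
  have e2 : φ ≫ α = φ' ≫ β := by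
    apply Spec.map_injective
    rw [Spec.map_comp, ← e, ← reassoc_of% h1, h2, Category.assoc, e', Spec.map_comp]
  obtain ⟨d, hd⟩ := hl i
  rw [← hq]
  refine .of_notMem j φ e q i _ d ?_ hd hn hl
  have hrq : Spec.map α r = q := by
    apply j.isOpenEmbedding.injective
    rw [hq, ← hr, ← Scheme.Hom.comp_apply, ← Scheme.Hom.comp_apply, h1]
  have hunit : IsUnit (α.hom d) := by
    obtain ⟨c, hc⟩ := hl' l
    have hni : (φ' ≫ β).hom (x i) ∈ nonZeroDivisors S :=
      mem_nonZeroDivisors_of_isOpenImmersion β hn'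
    have hA : (φ' ≫ β).hom (x i) = (φ' ≫ β).hom (x l) * α.hom d := by
      rw [← e2]; exact (congrArg α.hom hd).trans (map_mul _ _ _)
    have hB : (φ' ≫ β).hom (x l) = (φ' ≫ β).hom (x i) * β.hom c :=
      (congrArg β.hom hc).trans (map_mul _ _ _)
    have : (β.hom c * α.hom d - 1) * (φ' ≫ β).hom (x i) = 0 := by
      linear_combination -hA - hB * α.hom d
    have h1 := sub_eq_zero.mp (mem_nonZeroDivisors_iff_right.mp hni _ this)
    exact IsUnit.of_mul_eq_one _ ((mul_comm _ _).trans h1)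
  intro hdq
  rw [← hrq] at hdq
  exact r.2.ne_top (Ideal.eq_top_of_isUnit_mem _ hdq hunit)

end

/-! ### A criterion for open immersions; the chart substitutions of the blow-up -/

noncomputable section

/-- A morphism that has local retractions `s` of its restrictions over an open neighbourhood of
its image is an open immersion. -/
lemma isOpenImmersion_of_exists_section {C X : Scheme.{u}} (h : C ⟶ X)
    (H : ∀ c : C, ∃ (W : Scheme.{u}) (j : W ⟶ X) (_ : IsOpenImmersion j) (s : W ⟶ C),
      h c ∈ Set.range j ∧ s ≫ h = j ∧
      ∀ (O : C.Opens) (a : O.toScheme ⟶ W), a ≫ j = O.ι ≫ h → a ≫ s = O.ι) :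
    IsOpenImmersion h := by
  -- With `O` the preimage of the range of `j`, the retraction property makes `O ⟶ W` and `s`
  -- mutually inverse, so `h` restricted to `O` is `j` up to isomorphism. `O` contains whole fibres
  -- of `h`, which gives injectivity as well as the local statement.
  have key (c : C) : ∃ (O : C.Opens) (W : Scheme.{u}) (a : O.toScheme ⟶ W) (s : W ⟶ C),
      c ∈ O ∧ (∀ c', h c' = h c → c' ∈ O) ∧ a ≫ s = O.ι ∧ IsOpenImmersion (O.ι ≫ h) ∧
      (∀ y y', h (O.ι y) = h (O.ι y') → a y = a y') := by
    obtain ⟨W, j, hj, s, hc, hs, hr⟩ := H c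
    let O : C.Opens := h ⁻¹ᵁ j.opensRange
    have hO : Set.range (O.ι ≫ h) ⊆ Set.range j := by
      rintro _ ⟨y, rfl⟩
      rw [Scheme.Hom.comp_apply]
      exact y.2
    let a : O.toScheme ⟶ W := IsOpenImmersion.lift j (O.ι ≫ h) hO
    have ha : a ≫ j = O.ι ≫ h := IsOpenImmersion.lift_fac _ _ _
    have has : a ≫ s = O.ι := hr O a ha
    have hsO : Set.range s ⊆ Set.range O.ι := by
      rintro _ ⟨w, rfl⟩
      rw [Scheme.Opens.range_ι]
      change h (s w) ∈ Set.range j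
      rw [← Scheme.Hom.comp_apply, hs]
      exact ⟨w, rfl⟩
    let s' : W ⟶ O.toScheme := IsOpenImmersion.lift O.ι s hsO
    have hs' : s' ≫ O.ι = s := IsOpenImmersion.lift_fac _ _ _
    have h1 : a ≫ s' = 𝟙 _ := by
      rw [← cancel_mono O.ι, Category.assoc, hs', has, Category.id_comp]
    have h2 : s' ≫ a = 𝟙 _ := by
      rw [← cancel_mono j, Category.assoc, ha, reassoc_of% hs', hs, Category.id_comp]
    have : IsIso a := ⟨s', h1, h2⟩
    refine ⟨O, W, a, s, hc, fun c' hc' ↦ ?_, has, ?_, fun y y' e ↦ ?_⟩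
    · change h c' ∈ Set.range j
      rwa [hc']
    · rw [← ha]; infer_instance
    · apply j.isOpenEmbedding.injective
      rwa [← Scheme.Hom.comp_apply, ← Scheme.Hom.comp_apply, ha, Scheme.Hom.comp_apply,
        Scheme.Hom.comp_apply]
  refine IsOpenImmersion.of_forall_source_exists h (fun c c' e ↦ ?_) fun c ↦ ?_
  · obtain ⟨O, W, a, s, hc, hc', has, -, hi⟩ := key c
    obtain ⟨y, hy⟩ : c ∈ Set.range O.ι := by rwa [Scheme.Opens.range_ι]
    obtain ⟨y', hy'⟩ : c' ∈ Set.range O.ι := by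
      rw [Scheme.Opens.range_ι]; exact hc' c' e.symm
    have := congrArg s (hi y y' (by rw [hy, hy', e]))
    rwa [← Scheme.Hom.comp_apply, ← Scheme.Hom.comp_apply, has, hy, hy'] at this
  · obtain ⟨O, W, a, s, hc, -, -, hO, -⟩ := key c
    exact ⟨O, O.ι, inferInstance, by simpa using hc, hO⟩

/-- The polynomial ring in `n` variables. -/
abbrev polyRing (k : Type u) [Field k] (n : ℕ) : CommRingCat.{u} := .of (MvPolynomial (Fin n) k)

variable {k : Type u} [Field k] {n : ℕ}

/-- The ideal sheaf of the origin of affine space. -/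
def originIdeal (k : Type u) [Field k] (n : ℕ) : (Spec (polyRing k n)).IdealSheafData :=
  specIdeal (R := polyRing k n) (Ideal.span (Set.range (MvPolynomial.X : Fin n → polyRing k n)))

/-- The `i`-th chart of the blow-up of affine space at the origin: the substitution
`X l ↦ X i * X l` for `l ≠ i`, with `X i` fixed. -/
def chartHom (k : Type u) [Field k] {n : ℕ} (i : Fin n) : polyRing k n ⟶ polyRing k n :=
  CommRingCat.ofHom (MvPolynomial.aeval (R := k)
    (fun l ↦ if l = i then MvPolynomial.X i else
      MvPolynomial.X i * MvPolynomial.X l : Fin n → MvPolynomial (Fin n) k)).toRingHom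

lemma chartHom_C (i : Fin n) (a : k) :
    (chartHom k i).hom (MvPolynomial.C a) = MvPolynomial.C a :=
  MvPolynomial.aeval_C _ a

lemma chartHom_X_self (i : Fin n) :
    (chartHom k i).hom (MvPolynomial.X i) = MvPolynomial.X i :=
  (MvPolynomial.aeval_X _ i).trans (if_pos rfl)

lemma chartHom_X_of_ne {i l : Fin n} (h : l ≠ i) :
    (chartHom k i).hom (MvPolynomial.X l) = MvPolynomial.X i * MvPolynomial.X l :=
  (MvPolynomial.aeval_X _ l).trans (if_neg h)

lemma polyRing_hom_ext {R : CommRingCat.{u}} {φ ψ : polyRing k n ⟶ R}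
    (hC : ∀ a : k, φ.hom (MvPolynomial.C a) = ψ.hom (MvPolynomial.C a))
    (hX : ∀ l, φ.hom (MvPolynomial.X l) = ψ.hom (MvPolynomial.X l)) : φ = ψ :=
  CommRingCat.hom_ext (MvPolynomial.ringHom_ext hC hX)

/-- The factorization sends `X l` to a quotient of `φ (X l)` by `φ (X i)`, and keeps `X i`. -/
lemma exists_chartHom_comp_eq {R : CommRingCat.{u}} (φ : polyRing k n ⟶ R) (i : Fin n)
    (h : ∀ l, φ.hom (MvPolynomial.X i) ∣ φ.hom (MvPolynomial.X l)) :
    ∃ ψ : polyRing k n ⟶ R, chartHom k i ≫ ψ = φ := by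
  choose c hc using h
  let ψ : polyRing k n ⟶ R := CommRingCat.ofHom (MvPolynomial.eval₂Hom
    (φ.hom.comp MvPolynomial.C) (fun l ↦ if l = i then φ.hom (MvPolynomial.X i) else c l))
  have hψC (a : k) : ψ.hom (MvPolynomial.C a) = φ.hom (MvPolynomial.C a) :=
    MvPolynomial.eval₂Hom_C _ _ a
  have hψX (l : Fin n) : ψ.hom (MvPolynomial.X l) =
      if l = i then φ.hom (MvPolynomial.X i) else c l := MvPolynomial.eval₂Hom_X' _ _ l
  refine ⟨ψ, polyRing_hom_ext (fun a ↦ ?_) (fun l ↦ ?_)⟩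
  · rw [CommRingCat.hom_comp, RingHom.comp_apply, chartHom_C, hψC]
  · rw [CommRingCat.hom_comp, RingHom.comp_apply]
    by_cases hl : l = i
    · subst hl
      rw [chartHom_X_self, hψX, if_pos rfl]
    · rw [chartHom_X_of_ne hl, map_mul, hψX, hψX, if_pos rfl, if_neg hl, ← hc l]

/-- The quotients by `X i` are unique because `X i` maps to a non zero divisor. -/
lemma eq_of_chartHom_comp_eq {R : CommRingCat.{u}} {ψ ψ' : polyRing k n ⟶ R} (i : Fin n)
    (h : chartHom k i ≫ ψ = chartHom k i ≫ ψ')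
    (hn : (chartHom k i ≫ ψ).hom (MvPolynomial.X i) ∈ nonZeroDivisors R) : ψ = ψ' := by
  have hi : ψ.hom (MvPolynomial.X i) = ψ'.hom (MvPolynomial.X i) := by
    have := congr($(h).hom (MvPolynomial.X i))
    rwa [CommRingCat.hom_comp, RingHom.comp_apply, CommRingCat.hom_comp, RingHom.comp_apply,
      chartHom_X_self] at this
  rw [CommRingCat.hom_comp, RingHom.comp_apply, chartHom_X_self] at hn
  refine polyRing_hom_ext (fun a ↦ ?_) (fun l ↦ ?_)
  · have := congr($(h).hom (MvPolynomial.C a))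
    rwa [CommRingCat.hom_comp, RingHom.comp_apply, CommRingCat.hom_comp, RingHom.comp_apply,
      chartHom_C] at this
  · by_cases hl : l = i
    · rw [hl, hi]
    · have := congr($(h).hom (MvPolynomial.X l))
      rw [CommRingCat.hom_comp, RingHom.comp_apply, CommRingCat.hom_comp, RingHom.comp_apply,
        chartHom_X_of_ne hl, map_mul, map_mul, ← hi] at this
      have h0 : (ψ.hom (MvPolynomial.X l) - ψ'.hom (MvPolynomial.X l)) *
          ψ.hom (MvPolynomial.X i) = 0 := by linear_combination this
      exact sub_eq_zero.mp (mem_nonZeroDivisors_iff_right.mp hn _ h0)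

lemma isGeneratedAt_chartHom (i : Fin n) (y : Spec (polyRing k n)) :
    IsGeneratedAt (A := polyRing k n) MvPolynomial.X (Spec.map (chartHom k i)) i y := by
  refine ⟨polyRing k n, 𝟙 _, inferInstance, chartHom k i, ⟨y, rfl⟩, Category.id_comp _, ?_,
    fun l ↦ ?_⟩
  · rw [chartHom_X_self]
    exact mem_nonZeroDivisors_of_ne_zero (MvPolynomial.X_ne_zero i)
  · rw [chartHom_X_self]
    by_cases hl : l = i
    · rw [hl, chartHom_X_self]
    · rw [chartHom_X_of_ne hl]
      exact Dvd.intro _ rfl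

lemma isInvertibleIdeal_chartHom (i : Fin n) :
    IsInvertibleIdeal ((originIdeal k n).comap (Spec.map (chartHom k i))) :=
  isInvertibleIdeal_of_isGeneratedAt _ _ fun y ↦ ⟨i, isGeneratedAt_chartHom i y⟩

/-- The chart map is not a monomorphism, since it contracts the divisor `X i = 0`. It behaves like
one on morphisms with invertible inverse image ideal, for which `X i` stays a non zero divisor
locally. -/
lemma eq_of_comp_specMap_chartHom_eq {T : Scheme.{u}} {e e' : T ⟶ Spec (polyRing k n)} (i : Fin n)
    (h : e ≫ Spec.map (chartHom k i) = e' ≫ Spec.map (chartHom k i))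
    (hi : IsInvertibleIdeal ((originIdeal k n).comap (e ≫ Spec.map (chartHom k i)))) :
    e = e' := by
  refine Scheme.hom_ext_of_forall _ _ fun t ↦ ?_
  obtain ⟨R, j, hj, φ, ht, hφ, hn, -⟩ :=
    (isGeneratedAt_chartHom (k := k) i (e t)).comp e hi
  refine ⟨j.opensRange, ht, ?_⟩
  obtain ⟨ψ, hψ⟩ := Spec.map_surjective (j ≫ e)
  obtain ⟨ψ', hψ'⟩ := Spec.map_surjective (j ≫ e')
  have h1 : chartHom k i ≫ ψ = φ := Spec.map_injective (by
    rw [Spec.map_comp, hψ, Category.assoc, hφ])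
  have h2 : chartHom k i ≫ ψ' = φ := Spec.map_injective (by
    rw [Spec.map_comp, hψ', Category.assoc, ← h, hφ])
  have h3 : ψ = ψ' := eq_of_chartHom_comp_eq i (h1.trans h2.symm) (h1 ▸ hn)
  have h4 : j ≫ e = j ≫ e' := by rw [← hψ, ← hψ', h3]
  rw [← cancel_epi (j.isoOpensRange).hom, ← Category.assoc, ← Category.assoc,
    Scheme.Hom.isoOpensRange_hom_ι, h4]

end

/-! ### The blow-up of affine space at the origin: charts, overlaps, separatedness -/

noncomputable section

variable {k : Type u} [Field k] {n : ℕ}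

instance isZariskiLocalAtSource_locallyOfFiniteType :
    IsZariskiLocalAtSource (@LocallyOfFiniteType : MorphismProperty Scheme.{u}) :=
  HasRingHomProperty.instIsZariskiLocalAtSource (Q := RingHom.FiniteType)

/-- `f : X ⟶ 𝔸ⁿ` is the blow-up of the open subset `V` of `𝔸ⁿ` at the origin. -/
structure IsLocalBlowUp (V : (Spec (polyRing k n)).Opens) {X : Scheme.{u}}
    (f : X ⟶ Spec (polyRing k n)) : Prop where
  mem (x : X) : f x ∈ V
  invertible : IsInvertibleIdeal ((originIdeal k n).comap f)
  existsUnique_lift (T : Scheme.{u}) (g : T ⟶ Spec (polyRing k n)) (hg : ∀ t, g t ∈ V)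
    (hi : IsInvertibleIdeal ((originIdeal k n).comap g)) : ∃! h : T ⟶ X, h ≫ f = g

/-- The domain of the `i`-th chart of the blow-up of `V` at the origin. -/
def chartOpens (V : (Spec (polyRing k n)).Opens) (i : Fin n) : (Spec (polyRing k n)).Opens :=
  Spec.map (chartHom k i) ⁻¹ᵁ V

namespace IsLocalBlowUp

variable {V : (Spec (polyRing k n)).Opens} {X : Scheme.{u}} {f : X ⟶ Spec (polyRing k n)}

lemma isInvertibleIdeal_chartOpens (V : (Spec (polyRing k n)).Opens) (i : Fin n) :
    IsInvertibleIdeal ((originIdeal k n).comap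
      ((chartOpens V i).ι ≫ Spec.map (chartHom k i))) := by
  rw [Scheme.IdealSheafData.comap_comp]
  exact (isInvertibleIdeal_chartHom i).comap_of_isOpenImmersion _

lemma exists_chart (H : IsLocalBlowUp V f) (i : Fin n) :
    ∃ h : (chartOpens V i).toScheme ⟶ X,
      h ≫ f = (chartOpens V i).ι ≫ Spec.map (chartHom k i) := by
  refine (H.existsUnique_lift _ _ (fun t ↦ ?_) (isInvertibleIdeal_chartOpens V i)).exists
  rw [Scheme.Hom.comp_apply]
  exact t.2

/-- The `i`-th chart of a blow-up. -/
def chart (H : IsLocalBlowUp V f) (i : Fin n) : (chartOpens V i).toScheme ⟶ X :=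
  (H.exists_chart i).choose

lemma chart_comp (H : IsLocalBlowUp V f) (i : Fin n) :
    H.chart i ≫ f = (chartOpens V i).ι ≫ Spec.map (chartHom k i) :=
  (H.exists_chart i).choose_spec

lemma hom_ext (H : IsLocalBlowUp V f) {T : Scheme.{u}} {g g' : T ⟶ X} (h : g ≫ f = g' ≫ f)
    (hi : IsInvertibleIdeal ((originIdeal k n).comap (g ≫ f))) : g = g' := by
  refine (H.existsUnique_lift T (g ≫ f) (fun t ↦ ?_) hi).unique rfl h.symm
  rw [Scheme.Hom.comp_apply]
  exact H.mem _

/-- The factorization of rings gives a map to the chart over affine space; its composite with the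
chart is `j` by the uniqueness part of the universal property. -/
lemma exists_comp_chart_eq (H : IsLocalBlowUp V f) {R : CommRingCat.{u}} (j : Spec R ⟶ X)
    [IsOpenImmersion j] (i : Fin n) (ψ : polyRing k n ⟶ R)
    (e : j ≫ f = Spec.map (chartHom k i ≫ ψ)) :
    ∃ s : Spec R ⟶ (chartOpens V i).toScheme,
      s ≫ (chartOpens V i).ι = Spec.map ψ ∧ s ≫ H.chart i = j := by
  have hr : Set.range (Spec.map ψ) ⊆ Set.range (chartOpens V i).ι := by
    rintro _ ⟨r, rfl⟩
    rw [Scheme.Opens.range_ι]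
    change Spec.map (chartHom k i) (Spec.map ψ r) ∈ V
    rw [← Scheme.Hom.comp_apply, ← Spec.map_comp, ← e, Scheme.Hom.comp_apply]
    exact H.mem _
  have e' : IsOpenImmersion.lift (chartOpens V i).ι (Spec.map ψ) hr ≫ H.chart i ≫ f = j ≫ f := by
    rw [H.chart_comp, IsOpenImmersion.lift_fac_assoc, e, Spec.map_comp]
  refine ⟨IsOpenImmersion.lift (chartOpens V i).ι (Spec.map ψ) hr,
    IsOpenImmersion.lift_fac _ _ _, (H.hom_ext ?_ ?_).symm⟩
  · rw [← e', Category.assoc]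
  · rw [Scheme.IdealSheafData.comap_comp]
    exact H.invertible.comap_of_isOpenImmersion j

lemma isGeneratedAt_chart (H : IsLocalBlowUp V f) (i : Fin n) (y : (chartOpens V i).toScheme) :
    IsGeneratedAt (A := polyRing k n) MvPolynomial.X f i (H.chart i y) := by
  refine IsGeneratedAt.of_comp _ ?_ H.invertible
  rw [H.chart_comp]
  exact (isGeneratedAt_chartHom i _).comp _ (isInvertibleIdeal_chartOpens V i)

/-- Near the image of a point, `X i` generates the ideal on `X`, so dividing the other coordinates
by it gives a local map back to the chart. It inverts the chart by the two uniqueness statements: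
that of the universal property, and `eq_of_comp_specMap_chartHom_eq`. -/
instance isOpenImmersion_chart (H : IsLocalBlowUp V f) (i : Fin n) :
    IsOpenImmersion (H.chart i) := by
  refine isOpenImmersion_of_exists_section _ fun c ↦ ?_
  obtain ⟨R, j, hj, φ, hc, e, hn, hl⟩ := H.isGeneratedAt_chart i c
  obtain ⟨ψ, hψ⟩ := exists_chartHom_comp_eq φ i hl
  obtain ⟨s, hs, hs'⟩ := H.exists_comp_chart_eq j i ψ (hψ ▸ e)
  refine ⟨_, j, hj, s, hc, hs', fun O a ha ↦ ?_⟩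
  have e1 : (a ≫ s ≫ (chartOpens V i).ι) ≫ Spec.map (chartHom k i) =
      (O.ι ≫ (chartOpens V i).ι) ≫ Spec.map (chartHom k i) := by
    rw [Category.assoc, Category.assoc, Category.assoc, ← H.chart_comp, reassoc_of% hs',
      reassoc_of% ha]
  rw [← cancel_mono (chartOpens V i).ι, Category.assoc]
  refine eq_of_comp_specMap_chartHom_eq i e1 ?_
  rw [e1, Category.assoc, Scheme.IdealSheafData.comap_comp]
  exact (isInvertibleIdeal_chartOpens V i).comap_of_isOpenImmersion _

lemma mem_range_chart_iff (H : IsLocalBlowUp V f) (i : Fin n) (x : X) :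
    x ∈ Set.range (H.chart i) ↔ IsGeneratedAt (A := polyRing k n) MvPolynomial.X f i x := by
  constructor
  · rintro ⟨y, rfl⟩
    exact H.isGeneratedAt_chart i y
  · rintro ⟨R, j, hj, φ, ⟨r, rfl⟩, e, hn, hl⟩
    obtain ⟨ψ, hψ⟩ := exists_chartHom_comp_eq φ i hl
    obtain ⟨s, hs, hs'⟩ := H.exists_comp_chart_eq j i ψ (hψ ▸ e)
    exact ⟨s r, by rw [← Scheme.Hom.comp_apply, hs']⟩

lemma exists_mem_range_chart (H : IsLocalBlowUp V f) (x : X) : ∃ i, x ∈ Set.range (H.chart i) := by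
  obtain ⟨i, hi⟩ := exists_isGeneratedAt _ f H.invertible x
  exact ⟨i, (H.mem_range_chart_iff i x).mpr hi⟩

/-- In chart `i` the `l`-th coordinate of affine space becomes `X i * X l`, while `X i` generates
the ideal. So the `l`-th coordinate generates as well exactly where `X l` is a unit. -/
lemma chart_mem_range_chart_iff (H : IsLocalBlowUp V f) {i l : Fin n} (h : l ≠ i)
    (y : (chartOpens V i).toScheme) : H.chart i y ∈ Set.range (H.chart l) ↔
      (MvPolynomial.X l : MvPolynomial (Fin n) k) ∉
        PrimeSpectrum.asIdeal ((chartOpens V i).ι y) := by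
  rw [mem_range_chart_iff]
  constructor
  · intro hg
    replace hg := hg.comp (H.chart i) (by
      rw [H.chart_comp]; exact isInvertibleIdeal_chartOpens V i)
    rw [H.chart_comp] at hg
    replace hg := hg.of_comp _ (isInvertibleIdeal_chartHom i)
    obtain ⟨R, j, hj, φ, ⟨r, hr⟩, e, hn, hl⟩ := hg
    obtain ⟨ρ, rfl⟩ := Spec.map_surjective j
    rw [← Spec.map_comp] at e
    have e' := Spec.map_injective e
    subst e'
    have hu : IsUnit (ρ.hom (MvPolynomial.X l)) := by
      obtain ⟨c, hc⟩ := hl i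
      rw [CommRingCat.hom_comp, RingHom.comp_apply, chartHom_X_of_ne h, map_mul] at hn
      rw [CommRingCat.hom_comp, RingHom.comp_apply, RingHom.comp_apply, chartHom_X_of_ne h,
        chartHom_X_self, map_mul] at hc
      have h0 : (ρ.hom (MvPolynomial.X l) * c - 1) * ρ.hom (MvPolynomial.X i) = 0 := by
        linear_combination -hc
      exact IsUnit.of_mul_eq_one _ (sub_eq_zero.mp
        (mem_nonZeroDivisors_iff_right.mp (mul_mem_nonZeroDivisors.mp hn).1 _ h0))
    intro hmem
    rw [← hr] at hmem
    exact r.2.ne_top (Ideal.eq_top_of_isUnit_mem _ hmem hu)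
  · intro hl
    refine IsGeneratedAt.of_comp _ ?_ H.invertible
    rw [H.chart_comp]
    refine IsGeneratedAt.comp _ ?_ (isInvertibleIdeal_chartOpens V i)
    refine .of_notMem (𝟙 _) (chartHom k i) (Category.id_comp _) _ l (MvPolynomial.X i)
      (MvPolynomial.X l) hl (chartHom_X_of_ne h)
      (mem_nonZeroDivisors_of_ne_zero (MvPolynomial.X_ne_zero i)) fun m ↦ ?_
    by_cases hm : m = i
    · rw [hm, chartHom_X_self]
    · rw [chartHom_X_of_ne hm]
      exact Dvd.intro _ rfl

/-- The cover of a blow-up by its charts. -/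
def cover (H : IsLocalBlowUp V f) : Scheme.OpenCover.{0} X where
  I₀ := Fin n
  X i := chartOpens V i
  f i := H.chart i
  mem₀ := by
    rw [Scheme.presieve₀_mem_precoverage_iff]
    exact ⟨fun x ↦ H.exists_mem_range_chart x, fun i ↦ H.isOpenImmersion_chart i⟩

lemma isReduced (H : IsLocalBlowUp V f) : IsReduced X := by
  have (i : H.cover.I₀) : IsReduced (H.cover.X i) := by
    change IsReduced (chartOpens V i).toScheme
    exact isReduced_of_isOpenImmersion (chartOpens V i).ι
  exact IsReduced.of_openCover _ H.cover

lemma locallyOfFiniteType (H : IsLocalBlowUp V f) : LocallyOfFiniteType f := by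
  suffices h : ∀ i : Fin n, LocallyOfFiniteType (H.chart i ≫ f) from
    IsZariskiLocalAtSource.of_openCover H.cover h
  intro i
  rw [H.chart_comp]
  have : LocallyOfFiniteType (Spec.map (chartHom k i)) := by
    rw [HasRingHomProperty.Spec_iff (P := @LocallyOfFiniteType)]
    refine RingHom.FiniteType.of_comp_finiteType (f := (MvPolynomial.C : k →+* _)) ?_
    have : (chartHom k i).hom.comp (MvPolynomial.C : k →+* _) = MvPolynomial.C :=
      RingHom.ext fun a ↦ chartHom_C i a
    rw [this]
    exact RingHom.finiteType_algebraMap.mpr inferInstance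
  infer_instance

/-- A morphism from the spectrum of a local ring factors through every chart that contains the
image of the closed point. -/
lemma exists_comp_chart_eq_of_isLocalRing (H : IsLocalBlowUp V f) {R : CommRingCat.{u}}
    [IsLocalRing R] (g : Spec R ⟶ X) (i : Fin n) (z : Spec R)
    (hz : z = IsLocalRing.closedPoint R) (h : g z ∈ Set.range (H.chart i)) :
    ∃ (s : Spec R ⟶ (chartOpens V i).toScheme) (ψ : polyRing k n ⟶ R),
      s ≫ (chartOpens V i).ι = Spec.map ψ ∧ s ≫ H.chart i = g := by
  have hr : Set.range g ⊆ Set.range (H.chart i) := by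
    rintro _ ⟨r, rfl⟩
    have hrz : r ⤳ z := hz ▸ IsLocalRing.specializes_closedPoint r
    exact (hrz.map g.continuous).mem_open
      (H.chart i).isOpenEmbedding.isOpen_range h
  exact ⟨IsOpenImmersion.lift _ g hr, Spec.preimage _, (Spec.map_preimage _).symm,
    IsOpenImmersion.lift_fac _ _ _⟩

/-- The coordinate `X l` of chart `i` and the coordinate `X i` of chart `l` are inverse to each
other on the overlap. -/
lemma mul_eq_one_of_comp_chart_eq (H : IsLocalBlowUp V f) {K : CommRingCat.{u}}
    [Nonempty (Spec K)] [Subsingleton (Spec K)] {i l : Fin n} (hil : l ≠ i)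
    (s : Spec K ⟶ (chartOpens V i).toScheme) (s' : Spec K ⟶ (chartOpens V l).toScheme)
    (e : s ≫ H.chart i = s' ≫ H.chart l) (χ χ' : polyRing k n ⟶ K)
    (hχ : s ≫ (chartOpens V i).ι = Spec.map χ) (hχ' : s' ≫ (chartOpens V l).ι = Spec.map χ') :
    χ.hom (MvPolynomial.X l) * χ'.hom (MvPolynomial.X i) = 1 := by
  obtain ⟨z⟩ := ‹Nonempty (Spec K)›
  let x : X := (s ≫ H.chart i) z
  obtain ⟨R₁, j₁, hj₁, φ₁, hx₁, e₁, hn₁, hl₁⟩ := H.isGeneratedAt_chart i (s z)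
  obtain ⟨R₂, j₂, hj₂, φ₂, hx₂, e₂, hn₂, hl₂⟩ := H.isGeneratedAt_chart l (s' z)
  have hxx : H.chart i (s z) = H.chart l (s' z) := by
    rw [← Scheme.Hom.comp_apply, ← Scheme.Hom.comp_apply, e]
  rw [← hxx] at hx₂
  obtain ⟨S, j, hj, α, β, hβ, hxj, h₁, h₂⟩ :=
    exists_specMap_comp_eq_of_chart (𝟙 X) j₂ j₁ _ hx₁ hx₂
  rw [Category.comp_id] at h₁
  have hΦ : φ₁ ≫ β = φ₂ ≫ α := by
    apply Spec.map_injective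
    rw [Spec.map_comp, Spec.map_comp, ← e₁, ← e₂, ← reassoc_of% h₁, ← reassoc_of% h₂]
  have hf : j ≫ f = Spec.map (φ₁ ≫ β) := by rw [h₂, Category.assoc, e₁, Spec.map_comp]
  obtain ⟨ψ₁, hψ₁⟩ := exists_chartHom_comp_eq (φ₁ ≫ β) i (fun m ↦ map_dvd β.hom (hl₁ m))
  obtain ⟨ψ₂, hψ₂⟩ := exists_chartHom_comp_eq (φ₁ ≫ β) l
    (fun m ↦ hΦ ▸ map_dvd α.hom (hl₂ m))
  obtain ⟨t₁, ht₁, ht₁'⟩ := H.exists_comp_chart_eq j i ψ₁ (hψ₁ ▸ hf)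
  obtain ⟨t₂, ht₂, ht₂'⟩ := H.exists_comp_chart_eq j l ψ₂ (hψ₂ ▸ hf)
  -- The identity is `(x l / x i) * (x i / x l) = 1`. It is proved on a neighbourhood in the
  -- blow-up, where `x i` can be cancelled, and then specialized to `K`, where `x i` may be zero if
  -- the image lies on the exceptional divisor.
  have hone : ψ₁.hom (MvPolynomial.X l) * ψ₂.hom (MvPolynomial.X i) = 1 := by
    have hn : (φ₁ ≫ β).hom (MvPolynomial.X i) ∈ nonZeroDivisors S :=
      mem_nonZeroDivisors_of_isOpenImmersion β hn₁
    have a1 : (φ₁ ≫ β).hom (MvPolynomial.X i) = ψ₁.hom (MvPolynomial.X i) := by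
      rw [← hψ₁, CommRingCat.hom_comp, RingHom.comp_apply, chartHom_X_self]
    have a2 : (φ₁ ≫ β).hom (MvPolynomial.X l) =
        ψ₁.hom (MvPolynomial.X i) * ψ₁.hom (MvPolynomial.X l) := by
      rw [← hψ₁, CommRingCat.hom_comp, RingHom.comp_apply, chartHom_X_of_ne hil, map_mul]
    have b1 : (φ₁ ≫ β).hom (MvPolynomial.X l) = ψ₂.hom (MvPolynomial.X l) := by
      rw [← hψ₂, CommRingCat.hom_comp, RingHom.comp_apply, chartHom_X_self]
    have b2 : (φ₁ ≫ β).hom (MvPolynomial.X i) =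
        ψ₂.hom (MvPolynomial.X l) * ψ₂.hom (MvPolynomial.X i) := by
      rw [← hψ₂, CommRingCat.hom_comp, RingHom.comp_apply, chartHom_X_of_ne hil.symm, map_mul]
    have h0 : (ψ₁.hom (MvPolynomial.X l) * ψ₂.hom (MvPolynomial.X i) - 1) *
        (φ₁ ≫ β).hom (MvPolynomial.X i) = 0 := by
      linear_combination ψ₁.hom (MvPolynomial.X l) * ψ₂.hom (MvPolynomial.X i) * a1 - b2
        - ψ₂.hom (MvPolynomial.X i) * a2 + ψ₂.hom (MvPolynomial.X i) * b1
    exact sub_eq_zero.mp (mem_nonZeroDivisors_iff_right.mp hn _ h0)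
  have hr : Set.range (s ≫ H.chart i) ⊆ Set.range j := by
    rintro _ ⟨z', rfl⟩
    rw [Subsingleton.elim z' z]
    exact hxj
  obtain ⟨κ, hκ⟩ := Spec.map_surjective (IsOpenImmersion.lift j _ hr)
  have hκj : Spec.map κ ≫ j = s ≫ H.chart i := by rw [hκ, IsOpenImmersion.lift_fac]
  have c1 : χ = ψ₁ ≫ κ := by
    apply Spec.map_injective
    rw [← hχ, Spec.map_comp, ← ht₁, ← Category.assoc]
    congr 1
    rw [← cancel_mono (H.chart i), Category.assoc, ht₁', hκj]
  have c2 : χ' = ψ₂ ≫ κ := by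
    apply Spec.map_injective
    rw [← hχ', Spec.map_comp, ← ht₂, ← Category.assoc]
    congr 1
    rw [← cancel_mono (H.chart l), Category.assoc, ht₂', hκj, e]
  rw [c1, c2]
  have := congrArg κ.hom hone
  rwa [map_mul, map_one] at this

lemma isSeparated (H : IsLocalBlowUp V f) : IsSeparated f := by
  have := H.locallyOfFiniteType
  have : IsLocallyNoetherian X := LocallyOfFiniteType.isLocallyNoetherian f
  refine IsSeparated.of_valuativeCriterion f fun S ↦ ⟨fun g₁ g₂ ↦ ?_⟩
  obtain ⟨g₁, h₁, h₁'⟩ := g₁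
  obtain ⟨g₂, h₂, h₂'⟩ := g₂
  suffices g₁ = g₂ by subst this; rfl
  obtain ⟨z, hz⟩ : ∃ z : Spec (.of S.R), z = IsLocalRing.closedPoint S.R := ⟨_, rfl⟩
  obtain ⟨i, hi⟩ := H.exists_mem_range_chart (g₁ z)
  obtain ⟨l, hl⟩ := H.exists_mem_range_chart (g₂ z)
  obtain ⟨s₂, ψ₂, hs₂, hs₂'⟩ := H.exists_comp_chart_eq_of_isLocalRing (R := .of S.R) g₂ l z hz hl
  -- Once both morphisms land in the same affine-space chart, they agree because the valuation ring
  -- embeds in its fraction field.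
  suffices hil : g₁ z ∈ Set.range (H.chart l) by
    obtain ⟨s₁, ψ₁, hs₁, hs₁'⟩ := H.exists_comp_chart_eq_of_isLocalRing (R := .of S.R) g₁ l z hz hil
    have e : Spec.map (CommRingCat.ofHom (algebraMap S.R S.K)) ≫ s₁ =
        Spec.map (CommRingCat.ofHom (algebraMap S.R S.K)) ≫ s₂ := by
      rw [← cancel_mono (H.chart l), Category.assoc, Category.assoc, hs₁', hs₂', h₁, h₂]
    have e' : ψ₁ ≫ CommRingCat.ofHom (algebraMap S.R S.K) =
        ψ₂ ≫ CommRingCat.ofHom (algebraMap S.R S.K) := by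
      apply Spec.map_injective
      rw [Spec.map_comp, Spec.map_comp, ← hs₁, ← hs₂, reassoc_of% e]
    have e'' : ψ₁ = ψ₂ := by
      refine CommRingCat.hom_ext (RingHom.ext fun x ↦ ?_)
      exact IsFractionRing.injective S.R S.K congr($(e').hom x)
    have : s₁ = s₂ := by rw [← cancel_mono (chartOpens V l).ι, hs₁, hs₂, e'']
    rw [← hs₁', ← hs₂', this]
  by_cases hli : l = i
  · rwa [hli]
  obtain ⟨s₁, ψ₁, hs₁, hs₁'⟩ := H.exists_comp_chart_eq_of_isLocalRing (R := .of S.R) g₁ i z hz hi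
  rw [← hs₁', Scheme.Hom.comp_apply, H.chart_mem_range_chart_iff hli]
  have hone := H.mul_eq_one_of_comp_chart_eq (K := .of S.K) hli
    (Spec.map (CommRingCat.ofHom (algebraMap S.R S.K)) ≫ s₁)
    (Spec.map (CommRingCat.ofHom (algebraMap S.R S.K)) ≫ s₂)
    (by rw [Category.assoc, Category.assoc, hs₁', hs₂', h₁, h₂])
    (ψ₁ ≫ CommRingCat.ofHom (algebraMap S.R S.K)) (ψ₂ ≫ CommRingCat.ofHom (algebraMap S.R S.K))
    (by rw [Category.assoc, hs₁, Spec.map_comp]) (by rw [Category.assoc, hs₂, Spec.map_comp])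
  -- The coordinate relation holds in `S.K` between elements of `S.R`, hence in `S.R`. So `X l` is a
  -- unit at the closed point, which puts `g₁ z` in chart `l`.
  have hone' : ψ₁.hom (MvPolynomial.X l) * ψ₂.hom (MvPolynomial.X i) = 1 := by
    apply IsFractionRing.injective S.R S.K
    rw [map_mul, map_one]
    exact hone
  intro hmem
  rw [← Scheme.Hom.comp_apply, hs₁] at hmem
  exact z.2.ne_top
    (Ideal.eq_top_of_isUnit_mem _ hmem (IsUnit.of_mul_eq_one _ hone'))

lemma compactSpace (H : IsLocalBlowUp V f) : CompactSpace X := by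
  constructor
  have : (Set.univ : Set X) = ⋃ i, Set.range (H.chart i) := by
    ext x
    simpa using! H.exists_mem_range_chart x
  rw [this]
  refine isCompact_iUnion fun i ↦ ?_
  have : CompactSpace (chartOpens V i).toScheme :=
    isCompact_iff_compactSpace.mp (TopologicalSpace.NoetherianSpace.isCompact _)
  exact isCompact_range (H.chart i).continuous

end IsLocalBlowUp

end

/-! ### Ideals of points; restricting a blow-up to an open set or an affine chart -/

noncomputable section

variable {k : Type u} [Field k] {n : ℕ}

/-- The kernel of a substitution homomorphism `φ` with a partial inverse `s`. -/
lemma ker_eq_of_partialInverse {σ S : Type*} [CommRing S]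
    (φ : MvPolynomial σ k →+* S) (s : S →+* MvPolynomial σ k) (J : Ideal (MvPolynomial σ k))
    (hJ : J ≤ RingHom.ker φ) (hC : ∀ a, s (φ (MvPolynomial.C a)) = MvPolynomial.C a)
    (hX : ∀ l, s (φ (MvPolynomial.X l)) - MvPolynomial.X l ∈ J) : RingHom.ker φ = J := by
  refine le_antisymm (fun x hx ↦ ?_) hJ
  -- Modulo `J` the composite `s ∘ φ` is the identity, so whatever `φ` kills is zero modulo `J`.
  have h : (Ideal.Quotient.mk J).comp (s.comp φ) = Ideal.Quotient.mk J := by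
    refine MvPolynomial.ringHom_ext (fun a ↦ ?_) (fun l ↦ ?_)
    · rw [RingHom.comp_apply, RingHom.comp_apply, hC]
    · rw [RingHom.comp_apply, RingHom.comp_apply]
      exact Ideal.Quotient.eq.mpr (hX l)
  have := congr($h x)
  rw [RingHom.comp_apply, RingHom.comp_apply, hx, map_zero, map_zero] at this
  exact Ideal.Quotient.eq_zero_iff_mem.mp this.symm

/-- Evaluation of polynomials at the origin. -/
def evalOrigin (k : Type u) [Field k] (n : ℕ) : polyRing k n ⟶ .of k :=
  CommRingCat.ofHom MvPolynomial.constantCoeff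

lemma evalOrigin_X (l : Fin n) : (evalOrigin k n).hom (MvPolynomial.X l) = 0 :=
  MvPolynomial.constantCoeff_X k l

lemma evalOrigin_C (a : k) : (evalOrigin k n).hom (MvPolynomial.C a) = a :=
  MvPolynomial.constantCoeff_C (Fin n) a

lemma ker_evalOrigin : RingHom.ker (evalOrigin k n).hom =
    Ideal.span (Set.range (MvPolynomial.X : Fin n → MvPolynomial (Fin n) k)) := by
  refine ker_eq_of_partialInverse (evalOrigin k n).hom MvPolynomial.C _ ?_ (fun a ↦ ?_)
    (fun l ↦ ?_)
  · rw [Ideal.span_le]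
    rintro _ ⟨l, rfl⟩
    exact evalOrigin_X l
  · rw [evalOrigin_C]
  · rw [evalOrigin_X, map_zero, zero_sub]
    exact neg_mem (Ideal.subset_span ⟨l, rfl⟩)

lemma ker_specMap_evalOrigin : (Spec.map (evalOrigin k n)).ker = originIdeal k n := by
  rw [ker_specMap, ker_evalOrigin]
  rfl

/-- For an open immersion the inverse image ideal is plain restriction, which commutes with
intersections; this can fail for general morphisms. -/
lemma comap_iInf_of_isOpenImmersion {X Y : Scheme.{u}} {ι : Type*} [Finite ι]
    (I : ι → Y.IdealSheafData) (f : X ⟶ Y) [IsOpenImmersion f] :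
    (⨅ i, I i).comap f = ⨅ i, (I i).comap f := by
  refine Scheme.IdealSheafData.ext (funext fun U ↦ ?_)
  rw [Scheme.IdealSheafData.ideal_comap_of_isOpenImmersion, Scheme.IdealSheafData.ideal_iInf,
    Scheme.IdealSheafData.ideal_iInf, iInf_apply, iInf_apply, Ideal.comap_iInf]
  simp_rw [Scheme.IdealSheafData.ideal_comap_of_isOpenImmersion]

/-- Since `f` is a monomorphism, `g` is the pull-back of `g ≫ f` along `f`, and kernels are
compatible with restriction to opens. -/
lemma ker_comp_comap_of_isOpenImmersion {Z X Y : Scheme.{u}} (g : Z ⟶ X) (f : X ⟶ Y)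
    [IsOpenImmersion f] [QuasiCompact (g ≫ f)] : (g ≫ f).ker.comap f = g.ker := by
  refine Scheme.IdealSheafData.ext (funext fun U ↦ ?_)
  rw [Scheme.IdealSheafData.ideal_comap_of_isOpenImmersion]
  refine (Scheme.ker_ideal_of_isPullback_of_isOpenImmersion (g ≫ f) g (𝟙 Z) f ?_ U).symm
  exact ⟨⟨(Category.id_comp _).symm⟩, ⟨PullbackCone.IsLimit.mk _ (fun s ↦ s.snd)
    (fun s ↦ by rw [← cancel_mono f, Category.assoc, s.condition])
    (fun s ↦ Category.comp_id _) (fun s m _ h ↦ by rw [← h, Category.comp_id])⟩⟩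

lemma comap_eq_top_of_disjoint {X Y Z : Scheme.{u}} (g : Z ⟶ Y) [IsClosedImmersion g] (f : X ⟶ Y)
    (h : ∀ x, f x ∉ Set.range g) : g.ker.comap f = ⊤ := by
  rw [← Scheme.IdealSheafData.support_eq_bot_iff, Scheme.IdealSheafData.support_comap]
  refine TopologicalSpace.Closeds.ext (Set.eq_empty_of_forall_notMem fun x hx ↦ h x ?_)
  have : f x ∈ g.ker.support := hx
  have h2 := SetLike.mem_coe.mpr this
  rwa [Scheme.Hom.support_ker, g.isClosedEmbedding.isClosed_range.closure_eq] at h2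

namespace IsBlowUp

variable {X Y : Scheme.{u}} {π : X ⟶ Y} {I : Y.IdealSheafData}

/-- A blow-up is an isomorphism over the open sets that do not meet the centre. -/
lemma isIso_morphismRestrict (h : IsBlowUp π I) (U : Y.Opens) (hU : I.comap U.ι = ⊤) :
    IsIso (π ∣_ U) := by
  obtain ⟨g, hg, -⟩ := h.existsUnique_lift U.toScheme U.ι (by rw [hU]; exact isInvertibleIdeal_top)
  have hr : Set.range g ⊆ Set.range (π ⁻¹ᵁ U).ι := by
    rintro _ ⟨y, rfl⟩
    rw [Scheme.Opens.range_ι]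
    change π (g y) ∈ U
    rw [← Scheme.Hom.comp_apply, hg]
    exact y.2
  -- Both sides lift the same morphism to `Y`, whose inverse image ideal is invertible, so
  -- uniqueness identifies them.
  have e : π ∣_ U ≫ g = (π ⁻¹ᵁ U).ι := by
    refine (h.existsUnique_lift _ ((π ⁻¹ᵁ U).ι ≫ π) ?_).unique ?_ rfl
    · rw [Scheme.IdealSheafData.comap_comp]
      exact h.invertible.comap_of_isOpenImmersion _
    · rw [Category.assoc, hg, morphismRestrict_ι]
  refine ⟨IsOpenImmersion.lift _ g hr, ?_, ?_⟩
  · rw [← cancel_mono (π ⁻¹ᵁ U).ι, Category.assoc, IsOpenImmersion.lift_fac, e, Category.id_comp]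
  · rw [← cancel_mono U.ι, Category.assoc, morphismRestrict_ι, IsOpenImmersion.lift_fac_assoc, hg,
      Category.id_comp]

variable (c : Spec (polyRing k n) ⟶ Y) [IsOpenImmersion c] (V : (Spec (polyRing k n)).Opens)

lemma range_ι_comp_subset (π : X ⟶ Y) :
    Set.range ((π ⁻¹ᵁ (c ''ᵁ V)).ι ≫ π) ⊆ Set.range c := by
  rintro _ ⟨x, rfl⟩
  obtain ⟨y, -, hy⟩ : π ((π ⁻¹ᵁ (c ''ᵁ V)).ι x) ∈ c ''ᵁ V := x.2
  rw [Scheme.Hom.comp_apply]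
  exact ⟨y, hy⟩

/-- The restriction of `π` over the open subset `V` of an affine chart `c`. -/
def restrictChart (π : X ⟶ Y) : (π ⁻¹ᵁ (c ''ᵁ V)).toScheme ⟶ Spec (polyRing k n) :=
  IsOpenImmersion.lift c ((π ⁻¹ᵁ (c ''ᵁ V)).ι ≫ π) (range_ι_comp_subset c V π)

lemma restrictChart_comp (π : X ⟶ Y) :
    restrictChart c V π ≫ c = (π ⁻¹ᵁ (c ''ᵁ V)).ι ≫ π :=
  IsOpenImmersion.lift_fac _ _ _

lemma restrictChart_mem (π : X ⟶ Y) (x : (π ⁻¹ᵁ (c ''ᵁ V)).toScheme) :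
    restrictChart c V π x ∈ V := by
  obtain ⟨y, hy, hyx⟩ : π ((π ⁻¹ᵁ (c ''ᵁ V)).ι x) ∈ c ''ᵁ V := x.2
  have : c (restrictChart c V π x) = c y := by
    rw [← Scheme.Hom.comp_apply, restrictChart_comp, Scheme.Hom.comp_apply]
    exact hyx.symm
  rw [c.isOpenEmbedding.injective this]
  exact hy

/-- Morphisms into `V` are morphisms into `Y` that land in `c ''ᵁ V`, and for them the two inverse
image ideals agree. So the universal property of `π` restricts to that of the blow-up of the origin.
-/
lemma isLocalBlowUp (h : IsBlowUp π I)
    (hc : I.comap (V.ι ≫ c) = (originIdeal k n).comap V.ι) :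
    IsLocalBlowUp V (restrictChart c V π) := by
  have key {T : Scheme.{u}} (g : T ⟶ Spec (polyRing k n)) (hg : ∀ t, g t ∈ V) :
      (originIdeal k n).comap g = I.comap (g ≫ c) := by
    have hr : Set.range g ⊆ Set.range V.ι := by
      rintro _ ⟨t, rfl⟩
      rw [Scheme.Opens.range_ι]
      exact hg t
    obtain ⟨g', rfl⟩ : ∃ g', g' ≫ V.ι = g := ⟨_, IsOpenImmersion.lift_fac V.ι g hr⟩
    rw [Scheme.IdealSheafData.comap_comp, ← hc, ← Scheme.IdealSheafData.comap_comp,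
      Category.assoc]
  refine ⟨restrictChart_mem c V π, ?_, fun T g hg hi ↦ ?_⟩
  · rw [key _ (restrictChart_mem c V π), restrictChart_comp, Scheme.IdealSheafData.comap_comp]
    exact h.invertible.comap_of_isOpenImmersion _
  · rw [key g hg] at hi
    obtain ⟨h₀, hh₀, hu⟩ := h.existsUnique_lift T (g ≫ c) hi
    have hr : Set.range h₀ ⊆ Set.range (π ⁻¹ᵁ (c ''ᵁ V)).ι := by
      rintro _ ⟨t, rfl⟩
      rw [Scheme.Opens.range_ι]
      refine ⟨g t, hg t, ?_⟩
      exact congr($(hh₀.symm) t)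
    refine ⟨IsOpenImmersion.lift (π ⁻¹ᵁ (c ''ᵁ V)).ι h₀ hr, ?_, fun g' hg' ↦ ?_⟩
    · dsimp only
      rw [← cancel_mono c, Category.assoc, restrictChart_comp, IsOpenImmersion.lift_fac_assoc, hh₀]
    · rw [← cancel_mono (π ⁻¹ᵁ (c ''ᵁ V)).ι, IsOpenImmersion.lift_fac]
      refine hu _ ?_
      dsimp only
      rw [Category.assoc, ← restrictChart_comp, reassoc_of% hg']

end IsBlowUp

end

/-! ### The standard affine charts of projective space -/

noncomputable section

/-- Scaling all variables by `c` scales each monomial of degree `d` by `c ^ d`. It is used to undo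
dehomogenization. -/
lemma MvPolynomial.IsHomogeneous.map_eq_pow_mul {k σ L : Type*} [Field k] [CommRing L]
    {F : MvPolynomial σ k} {d : ℕ} (hF : F.IsHomogeneous d) (μ τ : MvPolynomial σ k →+* L) (c : L)
    (hC : ∀ a, τ (C a) = μ (C a)) (hX : ∀ l, τ (X l) = c * μ (X l)) : τ F = c ^ d * μ F := by
  rw [F.as_sum, map_sum, map_sum, Finset.mul_sum]
  refine Finset.sum_congr rfl fun m hm ↦ ?_
  rw [monomial_eq, map_mul, map_mul, hC, Finsupp.prod, map_prod, map_prod]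
  simp_rw [map_pow, hX, mul_pow]
  rw [Finset.prod_mul_distrib, Finset.prod_pow_eq_pow_sum]
  have : ∑ i ∈ m.support, m i = d := by
    have := hF.degree_eq_sum_deg_support hm
    exact this.symm
  rw [this]
  ring

variable (k : Type u) [Field k] {n : ℕ}

attribute [local instance] MvPolynomial.gradedAlgebra

open HomogeneousLocalization

/-- The grading on the homogeneous coordinate ring of `ℙⁿ`. -/
abbrev projGrading (n : ℕ) : ℕ → Submodule k (MvPolynomial (Fin (n + 1)) k) :=
  MvPolynomial.homogeneousSubmodule (Fin (n + 1)) k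

lemma X_mem_homogeneousSubmodule (i : Fin (n + 1)) :
    (MvPolynomial.X i : MvPolynomial (Fin (n + 1)) k) ∈ projGrading k n 1 :=
  MvPolynomial.isHomogeneous_X k i

/-- The ring homomorphism that identifies the polynomial ring with the functions on `D₊(X i)`. -/
def toAway (i : Fin (n + 1)) :
    MvPolynomial (Fin n) k →+*
      Away (projGrading k n) (MvPolynomial.X i : MvPolynomial (Fin (n + 1)) k) :=
  MvPolynomial.eval₂Hom
    ((fromZeroRingHom (projGrading k n) _).comp (algebraMap k (projGrading k n 0)))
    (fun j ↦ Away.mk (projGrading k n) (X_mem_homogeneousSubmodule k i) 1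
      (MvPolynomial.X (i.succAbove j))      (X_mem_homogeneousSubmodule k _))

lemma toAway_C (i : Fin (n + 1)) (a : k) : toAway k i (MvPolynomial.C a) =
    fromZeroRingHom (projGrading k n) _ (algebraMap k (projGrading k n 0) a) :=
  MvPolynomial.eval₂Hom_C _ _ a

lemma toAway_X (i : Fin (n + 1)) (j : Fin n) : toAway k i (MvPolynomial.X j) =
    Away.mk (projGrading k n) (X_mem_homogeneousSubmodule k i) 1 (MvPolynomial.X (i.succAbove j))
      (X_mem_homogeneousSubmodule k _) :=
  MvPolynomial.eval₂Hom_X' _ _ j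

lemma val_toAway_C (i : Fin (n + 1)) (a : k) : (toAway k i (MvPolynomial.C a)).val =
    algebraMap _ _ (MvPolynomial.C a : MvPolynomial (Fin (n + 1)) k) := by
  rw [toAway_C]
  rfl

lemma val_toAway_X_mul (i : Fin (n + 1)) (j : Fin n) :
    algebraMap _ _ (MvPolynomial.X i : MvPolynomial (Fin (n + 1)) k) *
      (toAway k i (MvPolynomial.X j)).val =
    algebraMap _ _ (MvPolynomial.X (i.succAbove j) : MvPolynomial (Fin (n + 1)) k) := by
  rw [toAway_X, Away.val_mk, Localization.mk_eq_mk', mul_comm]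
  have := IsLocalization.mk'_spec (M := Submonoid.powers (MvPolynomial.X i :
    MvPolynomial (Fin (n + 1)) k)) (Localization (Submonoid.powers (MvPolynomial.X i :
    MvPolynomial (Fin (n + 1)) k))) (MvPolynomial.X (i.succAbove j))
      ⟨MvPolynomial.X i ^ 1, 1, rfl⟩
  simpa only [pow_one] using this

/-- Setting the `i`-th homogeneous coordinate to one. -/
def dehomogenize (i : Fin (n + 1)) : MvPolynomial (Fin (n + 1)) k →+* MvPolynomial (Fin n) k :=
  MvPolynomial.eval₂Hom MvPolynomial.C (i.insertNth 1 MvPolynomial.X)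

lemma dehomogenize_X_self (i : Fin (n + 1)) : dehomogenize k i (MvPolynomial.X i) = 1 := by
  rw [dehomogenize, MvPolynomial.eval₂Hom_X', Fin.insertNth_apply_same]

lemma dehomogenize_X_succAbove (i : Fin (n + 1)) (j : Fin n) :
    dehomogenize k i (MvPolynomial.X (i.succAbove j)) = MvPolynomial.X j := by
  rw [dehomogenize, MvPolynomial.eval₂Hom_X', Fin.insertNth_apply_succAbove]

lemma dehomogenize_C (i : Fin (n + 1)) (a : k) :
    dehomogenize k i (MvPolynomial.C a) = MvPolynomial.C a :=
  MvPolynomial.eval₂Hom_C _ _ a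

/-- Setting `X i = 1` extends to the localization and gives a left inverse. Conversely a fraction `F
/ X i ^ d` with `F` homogeneous of degree `d` is the image of the dehomogenization of `F`. -/
lemma toAway_bijective (i : Fin (n + 1)) : Function.Bijective (toAway k i) := by
  let L := Localization.Away (MvPolynomial.X i : MvPolynomial (Fin (n + 1)) k)
  let v : Away (projGrading k n) (MvPolynomial.X i : MvPolynomial (Fin (n + 1)) k) →+* L :=
    algebraMap _ _
  have hvC (a : k) : v (toAway k i (MvPolynomial.C a)) = algebraMap _ L (MvPolynomial.C a) :=
    val_toAway_C k i a
  have hvX (j : Fin n) : algebraMap _ L (MvPolynomial.X i) * v (toAway k i (MvPolynomial.X j)) =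
      algebraMap _ L (MvPolynomial.X (i.succAbove j)) := val_toAway_X_mul k i j
  constructor
  · have hu : IsUnit (dehomogenize k i (MvPolynomial.X i)) := by
      rw [dehomogenize_X_self]; exact isUnit_one
    let r : L →+* MvPolynomial (Fin n) k := IsLocalization.Away.lift (MvPolynomial.X i) hu
    have hr (F) : r (algebraMap _ L F) = dehomogenize k i F :=
      IsLocalization.Away.lift_eq (MvPolynomial.X i) hu F
    have h : (r.comp v).comp (toAway k i) = RingHom.id _ := by
      refine MvPolynomial.ringHom_ext (fun a ↦ ?_) (fun j ↦ ?_)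
      · rw [RingHom.comp_apply, RingHom.comp_apply, hvC, hr, dehomogenize_C]
        rfl
      · rw [RingHom.comp_apply, RingHom.comp_apply]
        have := congrArg r (hvX j)
        rwa [map_mul, hr, hr, dehomogenize_X_self, one_mul, dehomogenize_X_succAbove] at this
    exact Function.LeftInverse.injective (g := r.comp v) fun x ↦ congr($h x)
  · intro z
    obtain ⟨d, F, hF, rfl⟩ :=
      Away.mk_surjective (projGrading k n) (X_mem_homogeneousSubmodule k i) z
    refine ⟨dehomogenize k i F, HomogeneousLocalization.val_injective _ ?_⟩
    have hF' : F.IsHomogeneous d := by simpa using hF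
    have := hF'.map_eq_pow_mul ((v.comp (toAway k i)).comp (dehomogenize k i))
      (algebraMap (MvPolynomial (Fin (n + 1)) k) L)
      (algebraMap (MvPolynomial (Fin (n + 1)) k) L (MvPolynomial.X i)) (fun a ↦ ?_) (fun l ↦ ?_)
    · rw [Away.val_mk, Localization.mk_eq_mk', eq_comm, IsLocalization.mk'_eq_iff_eq_mul, this,
        mul_comm, map_pow]
      rfl
    · rw [RingHom.comp_apply, RingHom.comp_apply, dehomogenize_C, hvC]
    · rw [RingHom.comp_apply, RingHom.comp_apply]
      obtain rfl | ⟨j, rfl⟩ := Fin.eq_self_or_eq_succAbove i l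
      · rw [dehomogenize_X_self, map_one, map_one, mul_one]
      · rw [dehomogenize_X_succAbove, hvX]

/-- The functions on `D₊(X i)` are polynomials. -/
def awayIso (i : Fin (n + 1)) : polyRing k n ≅
    .of (Away (projGrading k n) (MvPolynomial.X i : MvPolynomial (Fin (n + 1)) k)) :=
  (RingEquiv.ofBijective (toAway k i) (toAway_bijective k i)).toCommRingCatIso

/-- The standard affine chart `D₊(X i)` of projective space. -/
def projChart (i : Fin (n + 1)) : Spec (polyRing k n) ⟶ Proj (projGrading k n) :=
  Spec.map (awayIso k i).inv ≫
    Proj.awayι (projGrading k n) (MvPolynomial.X i) (X_mem_homogeneousSubmodule k i) one_pos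

instance isOpenImmersion_projChart (i : Fin (n + 1)) : IsOpenImmersion (projChart k i) := by
  delta projChart
  infer_instance

lemma range_projChart (i : Fin (n + 1)) :
    Set.range (projChart k i) = Proj.basicOpen (projGrading k n) (MvPolynomial.X i) := by
  have hs : Function.Surjective (Spec.map (awayIso k i).inv) :=
    (Spec.map (awayIso k i).inv).homeomorph.surjective
  rw [← Proj.opensRange_awayι (projGrading k n) (MvPolynomial.X i)
    (X_mem_homogeneousSubmodule k i) one_pos,
    projChart, Scheme.Hom.comp_base, TopCat.coe_comp, Set.range_comp,
    hs.range_eq, Set.image_univ]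
  rfl

lemma projChart_mem_basicOpen_iff (i : Fin (n + 1)) (j : Fin n) (y : Spec (polyRing k n)) :
    projChart k i y ∈ Proj.basicOpen (projGrading k n) (MvPolynomial.X (i.succAbove j)) ↔
      (MvPolynomial.X j : MvPolynomial (Fin n) k) ∉ PrimeSpectrum.asIdeal y := by
  have h := Proj.awayι_preimage_basicOpen (projGrading k n) (X_mem_homogeneousSubmodule k i) one_pos
    (X_mem_homogeneousSubmodule k (i.succAbove j)) one_pos
  have h1 : projChart k i y ∈ Proj.basicOpen (projGrading k n) (MvPolynomial.X (i.succAbove j)) ↔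
      Spec.map (awayIso k i).inv y ∈ Proj.awayι (projGrading k n) (MvPolynomial.X i)
        (X_mem_homogeneousSubmodule k i) one_pos ⁻¹ᵁ
          Proj.basicOpen (projGrading k n) (MvPolynomial.X (i.succAbove j)) := Iff.rfl
  have h2 : Away.isLocalizationElem (X_mem_homogeneousSubmodule k i)
      (X_mem_homogeneousSubmodule k (i.succAbove j)) = (awayIso k i).hom (MvPolynomial.X j) := by
    refine Eq.trans ?_ (toAway_X k i j).symm
    apply HomogeneousLocalization.val_injective
    simp [Away.isLocalizationElem]
  rw [h1, h, h2]
  change (awayIso k i).inv ((awayIso k i).hom (MvPolynomial.X j)) ∉ y.asIdeal ↔ _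
  rw [CategoryTheory.Iso.hom_inv_id_apply]

lemma projChart_toSpecZero (i : Fin (n + 1)) :
    projChart k i ≫ Proj.toSpecZero (projGrading k n) ≫
        Spec.map (CommRingCat.ofHom (algebraMap k (projGrading k n 0))) =
      Spec.map (CommRingCat.ofHom MvPolynomial.C) := by
  rw [projChart, Category.assoc, Proj.awayι_toSpecZero_assoc, ← Spec.map_comp, ← Spec.map_comp]
  congr 1
  rw [Iso.comp_inv_eq]
  refine CommRingCat.hom_ext (RingHom.ext fun a ↦ ?_)
  exact (toAway_C k i a).symm

lemma exists_mem_range_projChart (x : Proj (projGrading k n)) :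
    ∃ i, x ∈ Set.range (projChart k i) := by
  have h := Proj.iSup_basicOpen_eq_top' (projGrading k n)
    (MvPolynomial.X : Fin (n + 1) → MvPolynomial _ k)
    (fun i ↦ ⟨1, X_mem_homogeneousSubmodule k i⟩) ?_
  · obtain ⟨i, hi⟩ := TopologicalSpace.Opens.mem_iSup.mp (h.ge (Set.mem_univ x))
    exact ⟨i, by rw [range_projChart]; exact hi⟩
  · rw [eq_top_iff]
    rintro F -
    induction F using MvPolynomial.induction_on with
    | C a => exact Subalgebra.algebraMap_mem _ (algebraMap k (projGrading k n 0) a)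
    | add p q hp hq => exact add_mem hp hq
    | mul_X p i hp => exact mul_mem hp (Algebra.subset_adjoin ⟨i, rfl⟩)

end

/-! ### Computing in the Grothendieck ring: strata and affine spaces -/

noncomputable section

variable {k : Type u} [Field k]

namespace K0Var

lemma mk_eq_of_rel {a b : FreeCommRing (Variety k)} (h : K0Rel k a b) :
    Ideal.Quotient.mk (Ideal.ofRel (K0Rel k)) a = Ideal.Quotient.mk _ b :=
  Ideal.Quotient.eq.mpr (Ideal.subset_span ⟨a, b, h, sub_add_cancel a b⟩)

lemma cls_eq_of_iso {X Y : Variety k} (e : X.toOver ≅ Y.toOver) : cls X = cls Y :=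
  mk_eq_of_rel (.iso X Y e)

lemma cls_eq_add (X Z U : Variety k) (i : Z.toOver ⟶ X.toOver) (j : U.toOver ⟶ X.toOver)
    (hi : IsClosedImmersion i.left) (hj : IsOpenImmersion j.left)
    (h : IsCompl (Set.range i.left) (Set.range j.left)) : cls X = cls Z + cls U :=
  (mk_eq_of_rel (.scissor X Z U i j hi hj h)).trans (map_add _ _ _)

lemma cls_eq_mul (X Y P : Variety k) (fst : P.toOver ⟶ X.toOver) (snd : P.toOver ⟶ Y.toOver)
    (h : IsPullback fst.left snd.left X.toOver.hom Y.toOver.hom) : cls P = cls X * cls Y :=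
  (mk_eq_of_rel (.prod X Y P fst snd h)).trans (map_mul _ _ _)

lemma cls_eq_one (X : Variety k) (h : IsIso X.toOver.hom) : cls X = 1 :=
  (mk_eq_of_rel (.point X h)).trans (map_one _)

end K0Var

namespace Variety

lemma isNoetherian (X : Variety k) : AlgebraicGeometry.IsNoetherian X.toOver.left := by
  have := X.isVariety.locallyOfFiniteType
  have := X.isVariety.quasiCompact
  have : IsLocallyNoetherian X.toOver.left :=
    LocallyOfFiniteType.isLocallyNoetherian X.toOver.hom
  have : CompactSpace X.toOver.left := QuasiCompact.compactSpace_of_compactSpace X.toOver.hom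
  exact {}

/-- An open subvariety. -/
def restrict (X : Variety k) (U : X.toOver.left.Opens) : Variety k where
  toOver := Over.mk (U.ι ≫ X.toOver.hom)
  isVariety := by
    have := X.isNoetherian
    obtain ⟨h₁, h₂, h₃, h₄⟩ := X.isVariety
    have : TopologicalSpace.NoetherianSpace U.toScheme :=
      inferInstanceAs (TopologicalSpace.NoetherianSpace (U : Set X.toOver.left))
    exact ⟨isReduced_of_isOpenImmersion U.ι, by dsimp; infer_instance, by dsimp; infer_instance,
      by dsimp; infer_instance⟩

/-- The spectrum of a reduced `k`-algebra of finite type. -/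
def spec (k : Type u) [Field k] (A : Type u) [CommRing A] [Algebra k A] [Algebra.FiniteType k A]
    [_root_.IsReduced A] : Variety k where
  toOver := Over.mk (Spec.map (CommRingCat.ofHom (algebraMap k A)))
  isVariety := by
    refine ⟨?_, ?_, ?_, ?_⟩
    · dsimp; infer_instance
    · dsimp; infer_instance
    · refine (HasRingHomProperty.Spec_iff (P := @LocallyOfFiniteType)).mpr ?_
      exact RingHom.finiteType_algebraMap.mpr inferInstance
    · dsimp; infer_instance

end Variety

namespace K0Var

/-- The class of a locally closed stratum: if `Z` maps isomorphically onto the difference of two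
open subsets `W ≤ W'` of `X`, then `[W'] = [Z] + [W]`. -/
lemma cls_restrict_eq_add (X Z : Variety k) {W W' : X.toOver.left.Opens} (hW : W ≤ W')
    (i : Z.toOver ⟶ X.toOver) [IsPreimmersion i.left]
    (hi : Set.range i.left = (W' : Set X.toOver.left) \ W) :
    cls (X.restrict W') = cls Z + cls (X.restrict W) := by
  have hr : Set.range i.left ⊆ Set.range W'.ι := by
    rw [hi, Scheme.Opens.range_ι]
    exact Set.sdiff_subset
  let i' : Z.toOver.left ⟶ W'.toScheme := IsOpenImmersion.lift W'.ι i.left hr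
  have hi' : i' ≫ W'.ι = i.left := IsOpenImmersion.lift_fac _ _ _
  have hpre : IsPreimmersion (i' ≫ W'.ι) := by rw [hi']; infer_instance
  have : IsPreimmersion i' := .of_comp _ W'.ι
  have hri : Set.range i' = W'.ι ⁻¹' (W : Set X.toOver.left)ᶜ := by
    ext y
    constructor
    · rintro ⟨z, rfl⟩
      have : i.left z ∈ (W' : Set X.toOver.left) \ W := hi ▸ ⟨z, rfl⟩
      rw [← hi'] at this
      exact this.2
    · intro hy
      have : W'.ι y ∈ Set.range i.left := hi ▸ ⟨y.2, hy⟩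
      obtain ⟨z, hz⟩ := this
      refine ⟨z, W'.ι.isOpenEmbedding.injective ?_⟩
      rw [← hz, ← hi']
      rfl
  -- Inside `W'` the stratum is the complement of `W`, and a preimmersion with closed range is a
  -- closed immersion.
  have hcl : IsClosedImmersion i' := by
    refine .of_isPreimmersion i' ?_
    rw [hri]
    exact W.2.isClosed_compl.preimage W'.ι.continuous
  refine cls_eq_add (X.restrict W') Z (X.restrict W)
    (Over.homMk i' ?_) (Over.homMk (X.toOver.left.homOfLE hW) ?_) hcl ?_ ?_
  · change i' ≫ W'.ι ≫ X.toOver.hom = _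
    rw [reassoc_of% hi']
    exact Over.w i
  · change X.toOver.left.homOfLE hW ≫ W'.ι ≫ X.toOver.hom = W.ι ≫ X.toOver.hom
    rw [Scheme.homOfLE_ι_assoc]
  · change IsOpenImmersion (X.toOver.left.homOfLE hW)
    infer_instance
  · have hrj : Set.range (X.toOver.left.homOfLE hW) = W'.ι ⁻¹' (W : Set X.toOver.left) := by
      ext y
      constructor
      · rintro ⟨z, rfl⟩
        change W'.ι (X.toOver.left.homOfLE hW z) ∈ W
        rw [← Scheme.Hom.comp_apply, Scheme.homOfLE_ι]
        exact z.2
      · intro hy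
        obtain ⟨z, hz⟩ : W'.ι y ∈ Set.range W.ι := by
          rw [Scheme.Opens.range_ι]
          exact hy
        refine ⟨z, W'.ι.isOpenEmbedding.injective ?_⟩
        rw [← Scheme.Hom.comp_apply, Scheme.homOfLE_ι, hz]
    change IsCompl (Set.range i') (Set.range (X.toOver.left.homOfLE hW))
    rw [hri, hrj, Set.preimage_compl]
    exact isCompl_compl.symm

lemma cls_restrict_top (X : Variety k) : cls (X.restrict ⊤) = cls X :=
  cls_eq_of_iso (Over.isoMk (Scheme.topIso _) rfl)

/-- The empty scheme is the disjoint union of two copies of itself, so its class is its own double.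
-/
lemma cls_restrict_bot (X : Variety k) : cls (X.restrict ⊥) = 0 := by
  have : IsEmpty (X.restrict ⊥).toOver.left := ⟨fun x ↦ x.2⟩
  have hb : IsOpenImmersion ((⊥ : X.toOver.left.Opens).ι) := inferInstance
  have hc : IsClosedImmersion ((⊥ : X.toOver.left.Opens).ι) := by
    have : IsEmpty ((⊥ : X.toOver.left.Opens).toScheme) := ⟨fun x ↦ x.2⟩
    infer_instance
  have h := cls_restrict_eq_add X (X.restrict ⊥) (W := ⊥) (W' := ⊥) le_rfl
    (Over.homMk (⊥ : X.toOver.left.Opens).ι rfl) (by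
      change Set.range ((⊥ : X.toOver.left.Opens).ι) = _
      rw [Scheme.Opens.range_ι]
      simp)
  exact left_eq_add.mp h

section Affine

variable (A B : Type u) [CommRing A] [Algebra k A] [Algebra.FiniteType k A] [_root_.IsReduced A]
  [CommRing B] [Algebra k B] [Algebra.FiniteType k B] [_root_.IsReduced B]

variable {A B} in
lemma cls_spec_congr (e : A ≃ₐ[k] B) : cls (Variety.spec k A) = cls (Variety.spec k B) := by
  refine cls_eq_of_iso (Over.isoMk (Scheme.Spec.mapIso e.symm.toRingEquiv.toCommRingCatIso.op) ?_)
  change Spec.map (CommRingCat.ofHom (e.symm : B →+* A)) ≫ Spec.map _ = Spec.map _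
  rw [← Spec.map_comp]
  congr 1
  ext a
  exact e.symm.commutes a

lemma cls_spec_self : cls (Variety.spec k k) = 1 := by
  refine cls_eq_one _ ?_
  change IsIso (Spec.map (CommRingCat.ofHom (RingHom.id k)))
  have : IsIso (CommRingCat.ofHom (RingHom.id k)) := inferInstanceAs (IsIso (𝟙 (CommRingCat.of k)))
  infer_instance

-- `A[t]` is the pushout of `A` and `k[t]` over `k`, so its spectrum is the product with the affine
-- line.
attribute [local instance] Polynomial.algebra in
lemma cls_spec_polynomial [_root_.IsReduced (Polynomial A)] :
    cls (Variety.spec k (Polynomial A)) = cls (Variety.spec k A) * lefschetz k := by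
  refine cls_eq_mul (Variety.spec k A) (affineLine k) _
    (Over.homMk (Spec.map (CommRingCat.ofHom (algebraMap A (Polynomial A)))) ?_)
    (Over.homMk (Spec.map (CommRingCat.ofHom (algebraMap (Polynomial k) (Polynomial A)))) ?_) ?_
  · change Spec.map _ ≫ Spec.map _ = Spec.map _
    rw [← Spec.map_comp, ← CommRingCat.ofHom_comp, ← IsScalarTower.algebraMap_eq]
  · change Spec.map _ ≫ Spec.map _ = Spec.map _
    rw [← Spec.map_comp, ← CommRingCat.ofHom_comp, ← IsScalarTower.algebraMap_eq]
  · exact isPullback_SpecMap_of_isPushout _ _ _ _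
      (CommRingCat.isPushout_of_isPushout k A (Polynomial k) (Polynomial A))

end Affine

lemma cls_spec_mvPolynomial_fin (n : ℕ) :
    cls (Variety.spec k (MvPolynomial (Fin n) k)) = lefschetz k ^ n := by
  induction n with
  | zero => rw [cls_spec_congr (MvPolynomial.isEmptyAlgEquiv k (Fin 0)), cls_spec_self, pow_zero]
  | succ n ih =>
    rw [cls_spec_congr (MvPolynomial.finSuccEquiv k n), cls_spec_polynomial, ih, pow_succ]

lemma cls_spec_mvPolynomial (σ : Type) [Fintype σ] :
    cls (Variety.spec k (MvPolynomial σ k)) = lefschetz k ^ Fintype.card σ := by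
  rw [cls_spec_congr (MvPolynomial.renameEquiv k (Fintype.equivFin σ)), cls_spec_mvPolynomial_fin]

end K0Var

/-! ### Linear cells in affine space -/

section Cell

variable {n : ℕ} (k)

/-- The affine space of dimension `n - m`. -/
def cell (n m : ℕ) : Variety k := Variety.spec k (MvPolynomial {j : Fin n // m ≤ j} k)

/-- Setting the first `m` coordinates to zero. -/
def cellHom (n m : ℕ) : polyRing k n ⟶ .of (MvPolynomial {j : Fin n // m ≤ j} k) :=
  CommRingCat.ofHom (MvPolynomial.eval₂Hom MvPolynomial.C
    fun j ↦ if h : m ≤ j then MvPolynomial.X ⟨j, h⟩ else 0)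

lemma cellHom_C (m : ℕ) (a : k) : (cellHom k n m).hom (MvPolynomial.C a) = MvPolynomial.C a :=
  MvPolynomial.eval₂Hom_C _ _ a

lemma cellHom_X (m : ℕ) (j : Fin n) : (cellHom k n m).hom (MvPolynomial.X j) =
    if h : m ≤ j then MvPolynomial.X ⟨j, h⟩ else 0 :=
  MvPolynomial.eval₂Hom_X' _ _ j

lemma cls_cell (m : ℕ) :
    K0Var.cls (cell k n m) = lefschetz k ^ Fintype.card {j : Fin n // m ≤ j} :=
  K0Var.cls_spec_mvPolynomial _

/-- The inclusion of the linear subspace where the first `m` coordinates vanish. -/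
def cellι (n m : ℕ) : (cell k n m).toOver.left ⟶ Spec (polyRing k n) := Spec.map (cellHom k n m)

lemma cellHom_rename (m : ℕ) (p : MvPolynomial {j : Fin n // m ≤ j} k) :
    (cellHom k n m).hom (MvPolynomial.rename Subtype.val p) = p := by
  have : (cellHom k n m).hom.comp
      (MvPolynomial.rename (R := k) (Subtype.val : {j : Fin n // m ≤ j} → Fin n)).toRingHom =
      RingHom.id _ := by
    refine MvPolynomial.ringHom_ext (fun a ↦ ?_) (fun j ↦ ?_)
    · change (cellHom k n m).hom (MvPolynomial.rename Subtype.val (MvPolynomial.C a)) = _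
      rw [MvPolynomial.rename_C, cellHom_C]
      rfl
    · change (cellHom k n m).hom (MvPolynomial.rename Subtype.val (MvPolynomial.X j)) = _
      rw [MvPolynomial.rename_X, cellHom_X, dif_pos j.2]
      rfl
  exact congr($this p)

lemma cellHom_surjective (m : ℕ) : Function.Surjective (cellHom k n m).hom :=
  fun p ↦ ⟨_, cellHom_rename k m p⟩

instance isClosedImmersion_cellι (m : ℕ) : IsClosedImmersion (cellι k n m) :=
  IsClosedImmersion.spec_of_surjective _ (cellHom_surjective k m)

lemma cellι_comp (m : ℕ) : cellι k n m ≫ Spec.map (CommRingCat.ofHom MvPolynomial.C) =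
    (cell k n m).toOver.hom := by
  change Spec.map _ ≫ Spec.map _ = Spec.map _
  rw [← Spec.map_comp]
  congr 1
  refine CommRingCat.hom_ext (RingHom.ext fun a ↦ ?_)
  exact cellHom_C k m a

lemma ker_cellHom (m : ℕ) : RingHom.ker (cellHom k n m).hom =
    Ideal.span {p | ∃ j : Fin n, j < m ∧ MvPolynomial.X j = p} := by
  refine ker_eq_of_partialInverse (cellHom k n m).hom
    (MvPolynomial.rename (R := k) (Subtype.val : {j : Fin n // m ≤ j} → Fin n)).toRingHom _ ?_
    (fun a ↦ ?_) (fun l ↦ ?_)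
  · rw [Ideal.span_le]
    rintro _ ⟨j, hj, rfl⟩
    exact (cellHom_X k m j).trans (dif_neg hj.not_ge)
  · rw [cellHom_C]
    exact MvPolynomial.rename_C _ a
  · rw [cellHom_X]
    split_ifs with h
    · have : MvPolynomial.rename (R := k) (Subtype.val : {j : Fin n // m ≤ j} → Fin n)
        (MvPolynomial.X ⟨l, h⟩) = MvPolynomial.X l := MvPolynomial.rename_X _ _
      change MvPolynomial.rename _ _ - _ ∈ _
      rw [this, sub_self]
      exact zero_mem _
    · rw [map_zero, zero_sub]
      exact neg_mem (Ideal.subset_span ⟨l, not_le.mp h, rfl⟩)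

lemma mem_range_cellι_iff (m : ℕ) (y : Spec (polyRing k n)) : y ∈ Set.range (cellι k n m) ↔
    ∀ j : Fin n, j < m → (MvPolynomial.X j : MvPolynomial (Fin n) k) ∈ PrimeSpectrum.asIdeal y := by
  have h : Set.range (cellι k n m) =
      PrimeSpectrum.zeroLocus (RingHom.ker (cellHom k n m).hom : Set (polyRing k n)) :=
    range_comap_of_surjective _ _ (cellHom_surjective k m)
  rw [h, ker_cellHom, PrimeSpectrum.zeroLocus_span]
  exact ⟨fun H j hj ↦ H ⟨j, hj, rfl⟩, by rintro H _ ⟨j, hj, rfl⟩; exact H j hj⟩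

end Cell

end

/-! ### Projective space as a variety and its class -/

noncomputable section

variable {k : Type u} [Field k] {n : ℕ}

/-- A separated `k`-scheme that has a finite open cover by reduced quasi-compact schemes locally
of finite type over `k` is a variety. -/
lemma isVariety_of_openCover {X : Over (Spec (.of k))} (hs : IsSeparated X.hom) {ι : Type}
    [Finite ι] {U : ι → Scheme.{u}} (g : ∀ i, U i ⟶ X.left) [hg : ∀ i, IsOpenImmersion (g i)]
    (hx : ∀ x, ∃ i, x ∈ Set.range (g i)) (hr : ∀ i, IsReduced (U i))
    (hc : ∀ i, CompactSpace (U i)) (hf : ∀ i, LocallyOfFiniteType (g i ≫ X.hom)) :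
    IsVariety X := by
  let 𝒰 : Scheme.OpenCover.{0} X.left :=
    { I₀ := ι
      X := U
      f := g
      mem₀ := by
        rw [Scheme.presieve₀_mem_precoverage_iff]
        exact ⟨hx, hg⟩ }
  have : CompactSpace X.left := by
    constructor
    have : (Set.univ : Set X.left) = ⋃ i, Set.range (g i) := by
      ext x
      simpa using! hx x
    rw [this]
    exact isCompact_iUnion fun i ↦ isCompact_range (g i).continuous
  exact ⟨have (i : 𝒰.I₀) : IsReduced (𝒰.X i) := hr i
    IsReduced.of_openCover _ 𝒰, hs, IsZariskiLocalAtSource.of_openCover 𝒰 hf, inferInstance⟩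

lemma locallyOfFiniteType_specMap_C : LocallyOfFiniteType
    (Spec.map (CommRingCat.ofHom (MvPolynomial.C : k →+* MvPolynomial (Fin n) k))) := by
  refine (HasRingHomProperty.Spec_iff (P := @LocallyOfFiniteType)).mpr ?_
  exact RingHom.finiteType_algebraMap.mpr inferInstance

section ProjectiveSpace

attribute [local instance] MvPolynomial.gradedAlgebra

/-- Projective space as a variety. -/
def projSpace (k : Type u) [Field k] (n : ℕ) : Variety k where
  toOver := Over.mk (Y := Proj (projGrading k n))
    (Proj.toSpecZero (projGrading k n) ≫
      Spec.map (CommRingCat.ofHom (algebraMap k (projGrading k n 0))))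
  isVariety := by
    refine isVariety_of_openCover ?_ (fun i : Fin (n + 1) ↦ projChart k i)
      (fun x ↦ exists_mem_range_projChart k x) (fun i ↦ inferInstance) (fun i ↦ inferInstance)
      (fun i ↦ ?_)
    · dsimp; infer_instance
    · dsimp
      rw [projChart_toSpecZero]
      exact locallyOfFiniteType_specMap_C

/-- The standard affine charts of projective space. -/
def projSpaceChart (i : Fin (n + 1)) : Spec (polyRing k n) ⟶ (projSpace k n).toOver.left :=
  projChart k i

instance isOpenImmersion_projSpaceChart (i : Fin (n + 1)) :
    IsOpenImmersion (projSpaceChart (k := k) i) :=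
  isOpenImmersion_projChart k i

/-- The complement of a coordinate hyperplane. -/
def coordOpen (i : Fin (n + 1)) : (projSpace k n).toOver.left.Opens :=
  Proj.basicOpen (projGrading k n) (MvPolynomial.X i)

lemma range_projSpaceChart (i : Fin (n + 1)) :
    Set.range (projSpaceChart i) = (coordOpen (k := k) i : Set (projSpace k n).toOver.left) :=
  range_projChart k i

lemma projSpaceChart_mem_coordOpen_iff (i : Fin (n + 1)) (j : Fin n) (y : Spec (polyRing k n)) :
    projSpaceChart i y ∈ coordOpen (i.succAbove j) ↔
      (MvPolynomial.X j : MvPolynomial (Fin n) k) ∉ PrimeSpectrum.asIdeal y :=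
  projChart_mem_basicOpen_iff k i j y

lemma exists_mem_range_projSpaceChart (x : (projSpace k n).toOver.left) :
    ∃ i, x ∈ Set.range (projSpaceChart (k := k) i) := exists_mem_range_projChart k x

lemma projSpaceChart_comp_hom (i : Fin (n + 1)) : projSpaceChart i ≫ (projSpace k n).toOver.hom =
    Spec.map (CommRingCat.ofHom MvPolynomial.C) :=
  projChart_toSpecZero k i

/-- The points of projective space at which one of the first `m` coordinates does not vanish. -/
def projFiltration (k : Type u) [Field k] (n m : ℕ) : (projSpace k n).toOver.left.Opens :=
  ⨆ i : {i : Fin (n + 1) // i < m}, coordOpen i.1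

lemma mem_projFiltration {m : ℕ} {x : (projSpace k n).toOver.left} :
    x ∈ projFiltration k n m ↔ ∃ i : Fin (n + 1), i < m ∧ x ∈ coordOpen i := by
  refine TopologicalSpace.Opens.mem_iSup.trans ?_
  simp

lemma succAbove_eq_of_lt {m : Fin (n + 1)} {j : Fin n} (h : (j : ℕ) < m) :
    ((m.succAbove j : Fin (n + 1)) : ℕ) = j := by
  rw [Fin.succAbove_of_castSucc_lt _ _ h]
  rfl

/-- The stratum is where the homogeneous coordinates of index below `m` vanish and the `m`-th does
not. It lies in chart `m`, where affine and homogeneous indices below `m` coincide because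
`m.succAbove` fixes them. -/
lemma range_cellι_projChart (m : Fin (n + 1)) : Set.range (cellι k n m ≫ projSpaceChart m) =
    (projFiltration k n (m + 1) : Set (projSpace k n).toOver.left) \ projFiltration k n m := by
  ext x
  constructor
  · rintro ⟨z, rfl⟩
    rw [Scheme.Hom.comp_apply]
    have hz := (mem_range_cellι_iff k m (cellι k n m z)).mp ⟨z, rfl⟩
    refine ⟨mem_projFiltration.mpr ⟨m, Nat.lt_succ_self m, ?_⟩, fun h ↦ ?_⟩
    · exact (range_projSpaceChart (k := k) m).le ⟨_, rfl⟩
    · obtain ⟨i, hi, hx⟩ := mem_projFiltration.mp h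
      let j : Fin n := ⟨i, by omega⟩
      have hij : i = m.succAbove j := Fin.ext (succAbove_eq_of_lt (j := j) hi).symm
      rw [hij, projSpaceChart_mem_coordOpen_iff] at hx
      exact hx (hz j hi)
  · rintro ⟨h, h'⟩
    obtain ⟨i, hi, hx⟩ := mem_projFiltration.mp h
    obtain rfl : i = m := by
      by_contra hne
      have : (i : ℕ) ≠ m := fun h ↦ hne (Fin.ext h)
      exact h' (mem_projFiltration.mpr ⟨i, by omega, hx⟩)
    obtain ⟨y, rfl⟩ := (range_projSpaceChart (k := k) i).ge hx
    obtain ⟨z, rfl⟩ := (mem_range_cellι_iff k i y).mpr fun j hj ↦ by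
      by_contra hX
      refine h' (mem_projFiltration.mpr ⟨i.succAbove j, ?_,
        (projSpaceChart_mem_coordOpen_iff i j y).mpr hX⟩)
      rwa [succAbove_eq_of_lt hj]
    exact ⟨z, by rw [Scheme.Hom.comp_apply]⟩

lemma card_fin_ge (n m : ℕ) : Fintype.card {j : Fin n // m ≤ j} = n - m := by
  rw [Fintype.card_subtype]
  have h := Finset.card_filter_add_card_filter_not (s := Finset.univ)
    (fun j : Fin n ↦ (j : ℕ) < m)
  simp only [not_lt, Finset.card_univ, Fintype.card_fin] at h
  have := Fin.card_filter_val_lt (n := n) (m := m)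
  omega

lemma cls_restrict_projFiltration (m : ℕ) (hm : m ≤ n + 1) :
    K0Var.cls ((projSpace k n).restrict (projFiltration k n m)) =
      ∑ i ∈ Finset.range m, lefschetz k ^ (n - i) := by
  induction m with
  | zero =>
    have : projFiltration k n 0 = ⊥ :=
      eq_bot_iff.mpr fun x hx ↦ by simpa using mem_projFiltration.mp hx
    rw [this, K0Var.cls_restrict_bot, Finset.range_zero, Finset.sum_empty]
  | succ m ih =>
    let i : (cell k n m).toOver ⟶ (projSpace k n).toOver :=
      Over.homMk (cellι k n m ≫ projSpaceChart (⟨m, hm⟩ : Fin (n + 1))) (by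
        rw [Category.assoc, projSpaceChart_comp_hom, cellι_comp])
    have : IsPreimmersion i.left :=
      inferInstanceAs (IsPreimmersion (cellι k n m ≫ projSpaceChart (⟨m, hm⟩ : Fin (n + 1))))
    rw [K0Var.cls_restrict_eq_add _ (cell k n m) (W := projFiltration k n m) ?_ i
      (range_cellι_projChart ⟨m, hm⟩), ih (by omega), cls_cell, card_fin_ge,
      Finset.sum_range_succ, add_comm]
    intro x hx
    obtain ⟨i, hi, hx⟩ := mem_projFiltration.mp hx
    exact mem_projFiltration.mpr ⟨i, hi.trans (Nat.lt_succ_self m), hx⟩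

lemma cls_projSpace :
    K0Var.cls (projSpace k n) = ∑ i ∈ Finset.range (n + 1), lefschetz k ^ (n - i) := by
  rw [← cls_restrict_projFiltration _ le_rfl, ← K0Var.cls_restrict_top]
  congr 2
  refine (eq_top_iff.mpr fun x _ ↦ ?_).symm
  obtain ⟨i, hi⟩ := exists_mem_range_projSpaceChart (k := k) x
  exact mem_projFiltration.mpr ⟨i, i.2, (range_projSpaceChart (k := k) i).le hi⟩

end ProjectiveSpace

/-! ### Rational points as origins of affine charts -/

/-- An open immersion of affine space that sends the origin to the rational point `p`. -/
structure PointChart (n : ℕ) {Y : Over (Spec (.of k))} (p : RationalPoint Y) where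
  /-- the underlying morphism -/
  map : Spec (polyRing k n) ⟶ Y.left
  isOpenImmersion : IsOpenImmersion map
  comp_hom : map ≫ Y.hom = Spec.map (CommRingCat.ofHom MvPolynomial.C)
  origin_comp : Spec.map (evalOrigin k n) ≫ map = p.left

lemma rationalPoint_comp_hom {Y : Over (Spec (.of k))} (p : RationalPoint Y) :
    p.left ≫ Y.hom = 𝟙 (Spec (.of k)) := Over.w p

/-- A rational point in an affine chart lifts to an algebra homomorphism to `k`. -/
lemma exists_specMap_comp_eq_rationalPoint {Y : Over (Spec (.of k))} (p : RationalPoint Y)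
    (c : Spec (polyRing k n) ⟶ Y.left) [IsOpenImmersion c]
    (hc : c ≫ Y.hom = Spec.map (CommRingCat.ofHom MvPolynomial.C))
    (hp : ∀ z, p.left z ∈ Set.range c) :
    ∃ θ : polyRing k n ⟶ .of k, Spec.map θ ≫ c = p.left ∧
      ∀ a, θ.hom (MvPolynomial.C a) = a := by
  have hr : Set.range p.left ⊆ Set.range c := by
    rintro _ ⟨z, rfl⟩
    exact hp z
  obtain ⟨θ, hθ⟩ := Spec.map_surjective
    (R := polyRing k n) (S := .of k) (IsOpenImmersion.lift c p.left hr)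
  have h : Spec.map θ ≫ c = p.left := by rw [hθ, IsOpenImmersion.lift_fac]
  refine ⟨θ, h, fun a ↦ ?_⟩
  have h' : Spec.map (CommRingCat.ofHom MvPolynomial.C ≫ θ) = Spec.map (𝟙 (.of k)) := by
    rw [Spec.map_comp, ← hc, reassoc_of% h, rationalPoint_comp_hom, Spec.map_id]
  exact congr($(Spec.map_injective h').hom a)

/-- Translation of affine space by a vector. -/
def translation (a : Fin n → k) : polyRing k n ⟶ polyRing k n :=
  CommRingCat.ofHom (MvPolynomial.eval₂Hom MvPolynomial.C
    fun j ↦ MvPolynomial.X j + MvPolynomial.C (a j))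

lemma translation_C (a : Fin n → k) (b : k) :
    (translation a).hom (MvPolynomial.C b) = MvPolynomial.C b :=
  MvPolynomial.eval₂Hom_C _ _ b

lemma translation_X (a : Fin n → k) (j : Fin n) :
    (translation a).hom (MvPolynomial.X j) = MvPolynomial.X j + MvPolynomial.C (a j) :=
  MvPolynomial.eval₂Hom_X' _ _ j

lemma translation_comp_translation_neg (a b : Fin n → k) (h : a + b = 0) :
    translation a ≫ translation b = 𝟙 _ := by
  have h' (j : Fin n) : a j + b j = 0 := congrFun h j
  refine polyRing_hom_ext (fun c ↦ ?_) (fun j ↦ ?_)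
  · rw [CommRingCat.hom_comp, RingHom.comp_apply, translation_C, translation_C]
    rfl
  · rw [CommRingCat.hom_comp, RingHom.comp_apply, translation_X, map_add, translation_X,
      translation_C,
      add_assoc, ← map_add, add_comm (b j), h', map_zero, add_zero]
    rfl

instance isIso_translation (a : Fin n → k) : IsIso (translation a) :=
  ⟨translation (-a), translation_comp_translation_neg _ _ (add_neg_cancel a),
    translation_comp_translation_neg _ _ (neg_add_cancel a)⟩

/-- Every rational point of projective space is the origin of an affine chart. -/
lemma nonempty_pointChart (p : RationalPoint (projSpace k n).toOver) :
    Nonempty (PointChart n p) := by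
  let x : Spec (.of k) := default
  obtain ⟨i, hi⟩ := exists_mem_range_projSpaceChart (k := k) (p.left x)
  obtain ⟨θ, hθ, hC⟩ := exists_specMap_comp_eq_rationalPoint p (projSpaceChart i)
    (projSpaceChart_comp_hom i) (fun z ↦ by rwa [Subsingleton.elim (α := Spec (.of k)) z x])
  -- Translating by the coordinates `θ (X j)` of the point turns evaluation at the origin into
  -- evaluation at the point.
  let τ := translation fun j ↦ θ.hom (MvPolynomial.X j)
  have hτ : τ ≫ evalOrigin k n = θ := by
    refine polyRing_hom_ext (fun a ↦ ?_) (fun j ↦ ?_)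
    · rw [CommRingCat.hom_comp, RingHom.comp_apply, translation_C, evalOrigin_C, hC]
    · rw [CommRingCat.hom_comp, RingHom.comp_apply, translation_X, map_add, evalOrigin_X,
        evalOrigin_C, zero_add]
  refine ⟨⟨Spec.map τ ≫ projSpaceChart i, inferInstance, ?_, ?_⟩⟩
  · have h := projSpaceChart_comp_hom (k := k) i
    rw [Category.assoc]
    refine (congrArg (Spec.map τ ≫ ·) h).trans ?_
    dsimp only
    rw [← Spec.map_comp]
    congr 1
    refine CommRingCat.hom_ext (RingHom.ext fun a ↦ ?_)
    exact translation_C _ a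
  · rw [← Category.assoc, ← Spec.map_comp, hτ]
    exact hθ

/-- Distinct rational points have distinct images. -/
lemma eq_of_left_apply_eq {Y : Over (Spec (.of k))} {p q : RationalPoint Y} (c : PointChart n p)
    (x : Spec (.of k)) (h : p.left x = q.left x) : p = q := by
  have := c.isOpenImmersion
  obtain ⟨θ, hθ, hC⟩ := exists_specMap_comp_eq_rationalPoint q c.map c.comp_hom (fun z ↦ by
    rw [Subsingleton.elim (α := Spec (.of k)) z x, ← h, ← c.origin_comp]
    exact ⟨Spec.map (evalOrigin k n) x, rfl⟩)
  have hx : Spec.map (evalOrigin k n) x = Spec.map θ x := by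
    apply c.map.isOpenEmbedding.injective
    rw [← Scheme.Hom.comp_apply, ← Scheme.Hom.comp_apply, c.origin_comp, hθ]
    exact h
  have hbot : PrimeSpectrum.asIdeal x = ⊥ := by
    rw [Subsingleton.elim x (⟨⊥, Ideal.isPrime_bot⟩ : PrimeSpectrum k)]
  -- In the chart centred at `p`, the point `q` has the same image as the origin, so its coordinates
  -- lie in the zero ideal of `k`.
  have hθX (j : Fin n) : θ.hom (MvPolynomial.X j) = 0 := by
    have h1 : (MvPolynomial.X j : MvPolynomial (Fin n) k) ∈
        PrimeSpectrum.asIdeal (Spec.map (evalOrigin k n) x) := by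
      change (evalOrigin k n).hom (MvPolynomial.X j) ∈ PrimeSpectrum.asIdeal x
      rw [evalOrigin_X]
      exact zero_mem _
    rw [hx] at h1
    have h2 : θ.hom (MvPolynomial.X j) ∈ PrimeSpectrum.asIdeal x := h1
    rwa [hbot] at h2
  have hθe : evalOrigin k n = θ := by
    refine polyRing_hom_ext (fun a ↦ ?_) (fun j ↦ ?_)
    · rw [evalOrigin_C, hC]
    · rw [evalOrigin_X, hθX]
  apply Over.OverMorphism.ext
  rw [← c.origin_comp, ← hθ, hθe]

/-- A section over a one-point base is a closed immersion, with no separatedness of `Y` needed. -/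
lemma isClosedImmersion_rationalPoint {Y : Over (Spec (.of k))} (p : RationalPoint Y) :
    IsClosedImmersion p.left :=
  isClosedImmersion_of_comp_eq_id (Y := Spec (.of k)) Y.hom p.left (rationalPoint_comp_hom p)

end

/-! ### The cells of the exceptional divisor -/

noncomputable section

variable {k : Type u} [Field k] {n : ℕ}

/-- The origin of affine space. -/
def originPoint (k : Type u) [Field k] (n : ℕ) : Spec (polyRing k n) :=
  Spec.map (evalOrigin k n) (default : Spec (.of k))

lemma asIdeal_originPoint : PrimeSpectrum.asIdeal (originPoint k n) =
    Ideal.span (Set.range (MvPolynomial.X : Fin n → MvPolynomial (Fin n) k)) := by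
  rw [← ker_evalOrigin]
  obtain ⟨z, hz⟩ : ∃ z : Spec (.of k), z = default := ⟨_, rfl⟩
  have hbot : PrimeSpectrum.asIdeal z = ⊥ := by
    rw [Subsingleton.elim z (⟨⊥, Ideal.isPrime_bot⟩ : PrimeSpectrum k)]
  rw [originPoint, ← hz]
  change Ideal.comap (evalOrigin k n).hom (PrimeSpectrum.asIdeal z) = _
  rw [hbot]
  rfl

lemma eq_originPoint_iff (y : Spec (polyRing k n)) : y = originPoint k n ↔
    ∀ j, (MvPolynomial.X j : MvPolynomial (Fin n) k) ∈ PrimeSpectrum.asIdeal y := by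
  constructor
  · rintro rfl j
    rw [asIdeal_originPoint]
    exact Ideal.subset_span ⟨j, rfl⟩
  · intro h
    have hmax : (RingHom.ker (evalOrigin k n).hom).IsMaximal :=
      RingHom.ker_isMaximal_of_surjective (K := k) _ fun a ↦ ⟨MvPolynomial.C a, evalOrigin_C a⟩
    rw [ker_evalOrigin] at hmax
    refine PrimeSpectrum.ext (Eq.symm ?_)
    rw [asIdeal_originPoint]
    refine hmax.eq_of_le y.2.ne_top (Ideal.span_le.mpr ?_)
    rintro _ ⟨j, rfl⟩
    exact h j

/-- Every coordinate pulls back to a multiple of `X i`, so the exceptional divisor in chart `i` is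
`X i = 0`. -/
lemma specMap_chartHom_eq_originPoint_iff (i : Fin n) (y : Spec (polyRing k n)) :
    Spec.map (chartHom k i) y = originPoint k n ↔
      (MvPolynomial.X i : MvPolynomial (Fin n) k) ∈ PrimeSpectrum.asIdeal y := by
  rw [eq_originPoint_iff]
  change (∀ j, (chartHom k i).hom (MvPolynomial.X j) ∈ PrimeSpectrum.asIdeal y) ↔ _
  constructor
  · intro h
    have := h i
    rwa [chartHom_X_self] at this
  · intro h j
    by_cases hj : j = i
    · rw [hj, chartHom_X_self]
      exact h
    · rw [chartHom_X_of_ne hj]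
      exact Ideal.mul_mem_right _ _ h

namespace IsLocalBlowUp

variable {V : (Spec (polyRing k n)).Opens} {X : Scheme.{u}} {f : X ⟶ Spec (polyRing k n)}

lemma apply_chart (H : IsLocalBlowUp V f) (i : Fin n) (y : (chartOpens V i).toScheme) :
    f (H.chart i y) = Spec.map (chartHom k i) ((chartOpens V i).ι y) := by
  rw [← Scheme.Hom.comp_apply, H.chart_comp, Scheme.Hom.comp_apply]

lemma range_cellι_subset (hV : originPoint k n ∈ V) (i : Fin n) :
    Set.range (cellι k n (i + 1)) ⊆ Set.range (chartOpens V i).ι := by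
  intro y hy
  have h := (mem_range_cellι_iff k (i + 1) y).mp hy i (Nat.lt_succ_self i)
  rw [Scheme.Opens.range_ι]
  change Spec.map (chartHom k i) y ∈ V
  rwa [(specMap_chartHom_eq_originPoint_iff i y).mpr h]

/-- The `i`-th cell of the exceptional divisor. -/
def exceptionalCell (H : IsLocalBlowUp V f) (hV : originPoint k n ∈ V) (i : Fin n) :
    (cell k n (i + 1)).toOver.left ⟶ X :=
  IsOpenImmersion.lift (chartOpens V i).ι (cellι k n (i + 1)) (range_cellι_subset hV i) ≫ H.chart i

instance isPreimmersion_exceptionalCell (H : IsLocalBlowUp V f) (hV : originPoint k n ∈ V)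
    (i : Fin n) : IsPreimmersion (H.exceptionalCell hV i) := by
  have : IsPreimmersion (IsOpenImmersion.lift (chartOpens V i).ι (cellι k n (i + 1))
      (range_cellι_subset hV i) ≫ (chartOpens V i).ι) := by
    rw [IsOpenImmersion.lift_fac]
    infer_instance
  have := IsPreimmersion.of_comp (IsOpenImmersion.lift (chartOpens V i).ι (cellι k n (i + 1))
      (range_cellι_subset hV i)) (chartOpens V i).ι
  delta exceptionalCell
  infer_instance

lemma exceptionalCell_comp (H : IsLocalBlowUp V f) (hV : originPoint k n ∈ V) (i : Fin n) :
    H.exceptionalCell hV i ≫ f ≫ Spec.map (CommRingCat.ofHom MvPolynomial.C) =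
      (cell k n (i + 1)).toOver.hom := by
  rw [exceptionalCell, Category.assoc, reassoc_of% H.chart_comp, IsOpenImmersion.lift_fac_assoc,
    ← Spec.map_comp, ← cellι_comp]
  congr 2
  refine CommRingCat.hom_ext (RingHom.ext fun a ↦ ?_)
  exact chartHom_C i a

/-- In chart `i`, being exceptional means `X i = 0`, and lying outside chart `l` means `X l = 0`.
Together, for `l < i`, the first `i + 1` coordinates vanish, hence the parameter `i + 1` of the
cell. -/
lemma mem_range_exceptionalCell_iff (H : IsLocalBlowUp V f) (hV : originPoint k n ∈ V) (i : Fin n)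
    (x : X) : x ∈ Set.range (H.exceptionalCell hV i) ↔ f x = originPoint k n ∧
      x ∈ Set.range (H.chart i) ∧ ∀ l < i, x ∉ Set.range (H.chart l) := by
  constructor
  · rintro ⟨z, rfl⟩
    set y := IsOpenImmersion.lift (chartOpens V i).ι (cellι k n (i + 1))
      (range_cellι_subset hV i) z with hy
    have hx : H.exceptionalCell hV i z = H.chart i y := by
      rw [exceptionalCell, Scheme.Hom.comp_apply]
    have hyz : (chartOpens V i).ι y = cellι k n (i + 1) z := by
      rw [hy, ← Scheme.Hom.comp_apply, IsOpenImmersion.lift_fac]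
    have hc := (mem_range_cellι_iff k (i + 1) _).mp ⟨z, hyz.symm⟩
    rw [hx, H.apply_chart]
    refine ⟨(specMap_chartHom_eq_originPoint_iff i _).mpr (hc i (Nat.lt_succ_self i)),
      ⟨y, rfl⟩, fun l hl ↦ ?_⟩
    rw [H.chart_mem_range_chart_iff hl.ne]
    exact not_not_intro (hc l (Nat.lt_succ_of_lt hl))
  · rintro ⟨h0, ⟨y, rfl⟩, h⟩
    rw [H.apply_chart, specMap_chartHom_eq_originPoint_iff] at h0
    obtain ⟨z, hz⟩ := (mem_range_cellι_iff k (i + 1) ((chartOpens V i).ι y)).mpr fun j hj ↦ by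
      by_cases hji : j = i
      · rwa [hji]
      · have hlt : j < i := lt_of_le_of_ne (Nat.lt_succ_iff.mp hj) hji
        have := h j hlt
        rwa [H.chart_mem_range_chart_iff hji, not_not] at this
    refine ⟨z, ?_⟩
    rw [exceptionalCell, Scheme.Hom.comp_apply]
    congr 1
    apply (chartOpens V i).ι.isOpenEmbedding.injective
    rw [← Scheme.Hom.comp_apply, IsOpenImmersion.lift_fac, hz]

end IsLocalBlowUp

section RationalPoint

variable {Y : Over (Spec (.of k))}

/-- The point of the underlying space given by a rational point. -/
def pointImage (p : RationalPoint Y) : Y.left := p.left (default : Spec (.of k))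

lemma range_rationalPoint (p : RationalPoint Y) : Set.range p.left = {pointImage p} := by
  ext y
  constructor
  · rintro ⟨z, rfl⟩
    rw [Subsingleton.elim (α := Spec (.of k)) z default]
    rfl
  · rintro rfl
    exact ⟨(default : Spec (.of k)), rfl⟩

lemma isClosed_singleton_pointImage (p : RationalPoint Y) : IsClosed {pointImage p} := by
  have := isClosedImmersion_rationalPoint p
  rw [← range_rationalPoint]
  exact p.left.isClosedEmbedding.isClosed_range

lemma PointChart.map_originPoint {p : RationalPoint Y} (c : PointChart n p) :
    c.map (originPoint k n) = pointImage p := by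
  rw [originPoint, ← Scheme.Hom.comp_apply, c.origin_comp]
  rfl

/-- The complement of some of the points of a finite family of rational points. -/
def awayFrom {N : ℕ} (p : Fin N → RationalPoint Y) (S : Set (Fin N)) : Y.left.Opens :=
  ⟨(⋃ i ∈ S, {pointImage (p i)})ᶜ, (S.toFinite.isClosed_biUnion
    fun i _ ↦ isClosed_singleton_pointImage (p i)).isOpen_compl⟩

lemma mem_awayFrom {N : ℕ} {p : Fin N → RationalPoint Y} {S : Set (Fin N)} {y : Y.left} :
    y ∈ awayFrom p S ↔ ∀ i ∈ S, y ≠ pointImage (p i) := by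
  change y ∈ (⋃ i ∈ S, {pointImage (p i)})ᶜ ↔ _
  simp

end RationalPoint

end

/-! ### Blowing up several points: local structure and the variety property -/

noncomputable section

variable {k : Type u} [Field k] {n N : ℕ}

section Centre

variable {Y : Over (Spec (.of k))} {p : Fin N → RationalPoint Y}

/-- The part of the affine chart around the `i`-th point that avoids the other points. -/
def chartDomain (c : ∀ i, PointChart n (p i)) (i : Fin N) : (Spec (polyRing k n)).Opens :=
  (c i).map ⁻¹ᵁ awayFrom p {i}ᶜ

lemma mem_chartDomain {c : ∀ i, PointChart n (p i)} {i : Fin N} {y : Spec (polyRing k n)} :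
    y ∈ chartDomain c i ↔ ∀ j ≠ i, (c i).map y ≠ pointImage (p j) :=
  mem_awayFrom

lemma pointImage_ne (hp : Function.Injective p) (c : ∀ i, PointChart n (p i)) {i j : Fin N}
    (h : i ≠ j) : pointImage (p i) ≠ pointImage (p j) :=
  fun e ↦ h (hp (eq_of_left_apply_eq (c i) _ e))

lemma originPoint_mem_chartDomain (hp : Function.Injective p) (c : ∀ i, PointChart n (p i))
    (i : Fin N) : originPoint k n ∈ chartDomain c i :=
  mem_chartDomain.mpr fun j hj ↦ by
    rw [(c i).map_originPoint]
    exact pointImage_ne hp c hj.symm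

lemma comap_ker_rationalPoint_eq_top {T : Scheme.{u}} (q : RationalPoint Y) (f : T ⟶ Y.left)
    (h : ∀ t, f t ≠ pointImage q) : q.left.ker.comap f = ⊤ := by
  have := isClosedImmersion_rationalPoint q
  refine comap_eq_top_of_disjoint q.left f fun t ↦ ?_
  rw [range_rationalPoint]
  exact h t

lemma idealOfPoints_comap_awayFrom :
    (idealOfPoints p).comap (awayFrom p Set.univ).ι = ⊤ := by
  rw [idealOfPoints, comap_iInf_of_isOpenImmersion, iInf_eq_top]
  exact fun i ↦ comap_ker_rationalPoint_eq_top _ _ fun t ↦ mem_awayFrom.mp t.2 i trivial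

/-- The other points are absent from this domain, so their ideals become trivial and only the ideal
of the `i`-th point, the origin of the chart, survives in the intersection. -/
lemma idealOfPoints_comap_chartDomain (c : ∀ i, PointChart n (p i)) (i : Fin N) :
    (idealOfPoints p).comap ((chartDomain c i).ι ≫ (c i).map) =
      (originIdeal k n).comap (chartDomain c i).ι := by
  have := (c i).isOpenImmersion
  have hi : (p i).left.ker.comap ((chartDomain c i).ι ≫ (c i).map) =
      (originIdeal k n).comap (chartDomain c i).ι := by
    have := isClosedImmersion_rationalPoint (p i)
    have : QuasiCompact (Spec.map (evalOrigin k n) ≫ (c i).map) := by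
      rw [(c i).origin_comp]
      exact inferInstanceAs (QuasiCompact (p i).left)
    rw [Scheme.IdealSheafData.comap_comp, ← ker_specMap_evalOrigin,
      ← ker_comp_comap_of_isOpenImmersion (Spec.map (evalOrigin k n)) (c i).map, (c i).origin_comp]
  rw [idealOfPoints, comap_iInf_of_isOpenImmersion]
  refine le_antisymm ((iInf_le _ i).trans hi.le) (le_iInf fun j ↦ ?_)
  by_cases hj : j = i
  · rw [hj, hi]
  · rw [comap_ker_rationalPoint_eq_top (p j)]
    · exact le_top
    · intro t
      rw [Scheme.Hom.comp_apply]
      exact mem_chartDomain.mp t.2 j hj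

end Centre

namespace IsBlowUp

variable {Y : Variety k} {p : Fin N → RationalPoint Y.toOver} {X : Over (Spec (.of k))}
  {π : X ⟶ Y.toOver}

/-- The complement of the points, and a neighbourhood of each of the points. -/
def centreCover (c : ∀ i, PointChart n (p i)) : Option (Fin N) → Y.toOver.left.Opens
  | none => awayFrom p Set.univ
  | some i => have := (c i).isOpenImmersion; (c i).map ''ᵁ chartDomain c i

lemma pointImage_mem_centreCover (hp : Function.Injective p) (c : ∀ i, PointChart n (p i))
    (i : Fin N) : pointImage (p i) ∈ centreCover c (some i) :=
  ⟨originPoint k n, originPoint_mem_chartDomain hp c i, (c i).map_originPoint⟩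

lemma iSup_centreCover (hp : Function.Injective p) (c : ∀ i, PointChart n (p i)) :
    iSup (centreCover c) = ⊤ := by
  refine eq_top_iff.mpr fun y _ ↦ TopologicalSpace.Opens.mem_iSup.mpr ?_
  by_cases hy : ∃ i, y = pointImage (p i)
  · obtain ⟨i, rfl⟩ := hy
    exact ⟨some i, pointImage_mem_centreCover hp c i⟩
  · exact ⟨none, mem_awayFrom.mpr fun i _ h ↦ hy ⟨i, h⟩⟩

/-- The blow-up in the affine chart around the `i`-th point. -/
def overChart (c : ∀ i, PointChart n (p i)) (π : X ⟶ Y.toOver) (i : Fin N) :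
    (π.left ⁻¹ᵁ centreCover c (some i)).toScheme ⟶ Spec (polyRing k n) :=
  have := (c i).isOpenImmersion
  restrictChart (c i).map (chartDomain c i) π.left

lemma overChart_comp (c : ∀ i, PointChart n (p i)) (π : X ⟶ Y.toOver) (i : Fin N) :
    overChart c π i ≫ (c i).map = (π.left ⁻¹ᵁ centreCover c (some i)).ι ≫ π.left :=
  have := (c i).isOpenImmersion
  restrictChart_comp (c i).map (chartDomain c i) π.left

lemma isLocalBlowUp_overChart (h : IsBlowUp π.left (idealOfPoints p))
    (c : ∀ i, PointChart n (p i)) (i : Fin N) :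
    IsLocalBlowUp (chartDomain c i) (overChart c π i) :=
  have := (c i).isOpenImmersion
  isLocalBlowUp (c i).map (chartDomain c i) h (idealOfPoints_comap_chartDomain c i)

lemma isIso_morphismRestrict_awayFrom (h : IsBlowUp π.left (idealOfPoints p)) :
    IsIso (π.left ∣_ awayFrom p Set.univ) :=
  h.isIso_morphismRestrict _ idealOfPoints_comap_awayFrom

lemma overChart_comp_specMap_C (c : ∀ i, PointChart n (p i)) (π : X ⟶ Y.toOver) (i : Fin N) :
    overChart c π i ≫ Spec.map (CommRingCat.ofHom MvPolynomial.C) =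
      (π.left ⁻¹ᵁ centreCover c (some i)).ι ≫ X.hom := by
  rw [← (c i).comp_hom, reassoc_of% overChart_comp c π i, Over.w]

/-- Separatedness is local on the target: `π` is an isomorphism away from the points and a local
blow-up near each of them. -/
lemma isSeparated_of_pointCharts (h : IsBlowUp π.left (idealOfPoints p))
    (hp : Function.Injective p) (c : ∀ i, PointChart n (p i)) : IsSeparated π.left := by
  refine IsZariskiLocalAtTarget.of_iSup_eq_top (P := @IsSeparated) (centreCover c)
    (iSup_centreCover hp c) fun i ↦ ?_
  match i with
  | none =>
    have : IsIso (π.left ∣_ centreCover c none) := h.isIso_morphismRestrict_awayFrom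
    infer_instance
  | some i =>
    have := (c i).isOpenImmersion
    have := (h.isLocalBlowUp_overChart c i).isSeparated
    have : IsSeparated (π.left ∣_ centreCover c (some i) ≫ (centreCover c (some i)).ι) := by
      rw [morphismRestrict_ι, ← overChart_comp]
      infer_instance
    exact IsSeparated.of_comp _ (centreCover c (some i)).ι

lemma isVariety_of_pointCharts (h : IsBlowUp π.left (idealOfPoints p))
    (hp : Function.Injective p) (c : ∀ i, PointChart n (p i)) : IsVariety X := by
  have hsep := h.isSeparated_of_pointCharts hp c
  have hY := Y.isVariety
  have := hY.isSeparated
  have := hY.isReduced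
  have := hY.locallyOfFiniteType
  have := Y.isNoetherian
  have hw : π.left ≫ Y.toOver.hom = X.hom := Over.w π
  have hU : IsIso (π.left ∣_ centreCover c none) := h.isIso_morphismRestrict_awayFrom
  refine isVariety_of_openCover (by rw [← hw]; infer_instance)
    (fun i ↦ (π.left ⁻¹ᵁ centreCover c i).ι) (fun x ↦ ?_) (fun i ↦ ?_) (fun i ↦ ?_) (fun i ↦ ?_)
  · obtain ⟨i, hi⟩ := TopologicalSpace.Opens.mem_iSup.mp
      ((iSup_centreCover hp c).ge (Set.mem_univ (π.left x)))
    refine ⟨i, ?_⟩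
    rw [Scheme.Opens.range_ι]
    exact hi
  · match i with
    | none =>
      have := isReduced_of_isOpenImmersion (centreCover c none).ι
      exact isReduced_of_isOpenImmersion (π.left ∣_ centreCover c none)
    | some i => exact (h.isLocalBlowUp_overChart c i).isReduced
  · match i with
    | none =>
      have : CompactSpace (centreCover c none).toScheme :=
        isCompact_iff_compactSpace.mp (TopologicalSpace.NoetherianSpace.isCompact _)
      exact (π.left ∣_ centreCover c none).homeomorph.symm.compactSpace
    | some i => exact (h.isLocalBlowUp_overChart c i).compactSpace
  · match i with
    | none =>
      rw [← hw, ← Category.assoc, ← morphismRestrict_ι]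
      infer_instance
    | some i =>
      have := (h.isLocalBlowUp_overChart c i).locallyOfFiniteType
      have := locallyOfFiniteType_specMap_C (k := k) (n := n)
      rw [← overChart_comp_specMap_C]
      infer_instance

end IsBlowUp

end

/-! ### Counting cells: the class of the blow-up -/

noncomputable section

variable {k : Type u} [Field k] {n N : ℕ}

/-- The complement of the points with index at least `m`. -/
def awayFromGe {Y : Over (Spec (.of k))} (p : Fin N → RationalPoint Y) (m : ℕ) : Y.left.Opens :=
  awayFrom p {j | m ≤ j}

section Filtration

variable {Y : Over (Spec (.of k))} {p : Fin N → RationalPoint Y}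

lemma mem_awayFromGe {m : ℕ} {y : Y.left} :
    y ∈ awayFromGe p m ↔ ∀ j : Fin N, m ≤ j → y ≠ pointImage (p j) := mem_awayFrom

lemma awayFromGe_zero : awayFromGe p 0 = awayFrom p Set.univ := by
  simp [awayFromGe]

lemma awayFromGe_eq_top : awayFromGe p N = ⊤ :=
  eq_top_iff.mpr fun _ _ ↦ mem_awayFromGe.mpr fun j hj ↦ absurd j.2 hj.not_gt

lemma awayFromGe_le (m : ℕ) : awayFromGe p m ≤ awayFromGe p (m + 1) :=
  fun _ hy ↦ mem_awayFromGe.mpr fun j hj ↦ mem_awayFromGe.mp hy j (Nat.le_of_succ_le hj)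

lemma eq_pointImage_of_mem_of_notMem {i : Fin N} {y : Y.left} (h : y ∈ awayFromGe p (i + 1))
    (h' : y ∉ awayFromGe p i) : y = pointImage (p i) := by
  by_contra hy
  refine h' (mem_awayFromGe.mpr fun j hj ↦ ?_)
  obtain hj | hj := hj.eq_or_lt
  · rwa [← Fin.ext hj]
  · exact mem_awayFromGe.mp h j hj

lemma pointImage_notMem_awayFromGe (i : Fin N) : pointImage (p i) ∉ awayFromGe p i :=
  fun h ↦ mem_awayFromGe.mp h i le_rfl rfl

end Filtration

/-- A point as a variety. -/
def pointVariety (k : Type u) [Field k] : Variety k where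
  toOver := Over.mk (𝟙 (Spec (.of k)))
  isVariety := by
    refine ⟨?_, ?_, ?_, ?_⟩ <;> dsimp <;> infer_instance

lemma cls_pointVariety : K0Var.cls (pointVariety k) = 1 :=
  K0Var.cls_eq_one _ (inferInstanceAs (IsIso (𝟙 (Spec (.of k)))))

/-- Removing finitely many rational points from a variety. -/
lemma cls_restrict_awayFromGe {Y : Variety k} {p : Fin N → RationalPoint Y.toOver}
    (hp : Function.Injective (pointImage ∘ p)) (m : ℕ) (hm : m ≤ N) :
    K0Var.cls (Y.restrict (awayFromGe p m)) =
      m + K0Var.cls (Y.restrict (awayFrom p Set.univ)) := by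
  induction m with
  | zero => rw [awayFromGe_zero, Nat.cast_zero, zero_add]
  | succ m ih =>
    have h := isClosedImmersion_rationalPoint (p ⟨m, hm⟩)
    let i : (pointVariety k).toOver ⟶ Y.toOver := p ⟨m, hm⟩
    have : IsPreimmersion i.left := inferInstanceAs (IsPreimmersion (p ⟨m, hm⟩).left)
    rw [K0Var.cls_restrict_eq_add Y (pointVariety k) (awayFromGe_le m) i, ih (by omega),
      cls_pointVariety, Nat.cast_succ]
    · ring
    · change Set.range (p ⟨m, hm⟩).left = _
      rw [range_rationalPoint]
      ext y
      rw [Set.mem_sdiff, SetLike.mem_coe, SetLike.mem_coe, Set.mem_singleton_iff]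
      constructor
      · rintro rfl
        refine ⟨mem_awayFromGe.mpr fun j hj e ↦ ?_,
          pointImage_notMem_awayFromGe (p := p) ⟨m, hm⟩⟩
        have : m = j := congrArg Fin.val (hp e)
        omega
      · rintro ⟨h, h'⟩
        exact eq_pointImage_of_mem_of_notMem (i := ⟨m, hm⟩) h h'

namespace IsBlowUp

variable {Y : Variety k} {p : Fin N → RationalPoint Y.toOver} {X : Variety k}
  {π : X.toOver ⟶ Y.toOver}

/-- The charts of the blow-up around the `i`-th point. -/
def localChart (h : IsBlowUp π.left (idealOfPoints p)) (c : ∀ i, PointChart n (p i)) (i : Fin N)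
    (a : Fin n) : (chartOpens (chartDomain c i) a).toScheme ⟶ X.toOver.left :=
  (h.isLocalBlowUp_overChart c i).chart a ≫ (π.left ⁻¹ᵁ centreCover c (some i)).ι

instance isOpenImmersion_localChart (h : IsBlowUp π.left (idealOfPoints p))
    (c : ∀ i, PointChart n (p i)) (i : Fin N) (a : Fin n) :
    IsOpenImmersion (h.localChart c i a) := by
  delta localChart
  infer_instance

/-- The part of the blow-up where the first `i` points are blown up, together with the first `b`
charts around the next point. -/
def blowUpFiltration (h : IsBlowUp π.left (idealOfPoints p)) (c : ∀ i, PointChart n (p i))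
    (i : Fin N) (b : ℕ) : X.toOver.left.Opens :=
  π.left ⁻¹ᵁ awayFromGe p i ⊔ ⨆ a : {a : Fin n // a < b}, (h.localChart c i a.1).opensRange

lemma mem_blowUpFiltration {h : IsBlowUp π.left (idealOfPoints p)} {c : ∀ i, PointChart n (p i)}
    {i : Fin N} {b : ℕ} {x : X.toOver.left} : x ∈ h.blowUpFiltration c i b ↔
      π.left x ∈ awayFromGe p i ∨ ∃ a : Fin n, a < b ∧ x ∈ Set.range (h.localChart c i a) := by
  refine or_congr Iff.rfl (TopologicalSpace.Opens.mem_iSup.trans ?_)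
  exact ⟨fun ⟨⟨a, ha⟩, hx⟩ ↦ ⟨a, ha, hx⟩, fun ⟨a, ha, hx⟩ ↦ ⟨⟨a, ha⟩, hx⟩⟩

lemma mem_range_localChart_iff (h : IsBlowUp π.left (idealOfPoints p))
    (c : ∀ i, PointChart n (p i)) (i : Fin N) (a : Fin n)
    (x : (π.left ⁻¹ᵁ centreCover c (some i)).toScheme) :
    (π.left ⁻¹ᵁ centreCover c (some i)).ι x ∈ Set.range (h.localChart c i a) ↔
      x ∈ Set.range ((h.isLocalBlowUp_overChart c i).chart a) := by
  constructor
  · rintro ⟨y, hy⟩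
    refine ⟨y, (π.left ⁻¹ᵁ centreCover c (some i)).ι.isOpenEmbedding.injective ?_⟩
    rw [← hy, localChart, Scheme.Hom.comp_apply]
  · rintro ⟨y, rfl⟩
    exact ⟨y, by rw [localChart, Scheme.Hom.comp_apply]⟩

lemma overChart_eq_originPoint_iff (c : ∀ i, PointChart n (p i)) (i : Fin N)
    (x : (π.left ⁻¹ᵁ centreCover c (some i)).toScheme) :
    overChart c π i x = originPoint k n ↔
      π.left ((π.left ⁻¹ᵁ centreCover c (some i)).ι x) = pointImage (p i) := by
  have := (c i).isOpenImmersion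
  rw [← Scheme.Hom.comp_apply, ← overChart_comp, Scheme.Hom.comp_apply, ← (c i).map_originPoint]
  exact (c i).map.isOpenEmbedding.injective.eq_iff.symm

lemma ne_pointImage_of_mem_centreCover (c : ∀ i, PointChart n (p i)) {i j : Fin N} (hj : j ≠ i)
    {y : Y.toOver.left} (hy : y ∈ centreCover c (some i)) : y ≠ pointImage (p j) := by
  obtain ⟨z, hz, rfl⟩ := hy
  exact mem_chartDomain.mp hz j hj

lemma mem_awayFromGe_iff_of_mem_centreCover (c : ∀ i, PointChart n (p i)) {i : Fin N}
    {y : Y.toOver.left} (hy : y ∈ centreCover c (some i)) :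
    y ∈ awayFromGe p i ↔ y ≠ pointImage (p i) := by
  refine ⟨fun h ↦ mem_awayFromGe.mp h i le_rfl, fun h ↦ mem_awayFromGe.mpr fun j hj ↦ ?_⟩
  by_cases hji : j = i
  · rwa [hji]
  · exact ne_pointImage_of_mem_centreCover c hji hy

/-- Outside the fibre over the `i`-th point, the charts around it already lie in the first open set,
since their domain avoids all other points. Adding chart `b` therefore adds only the `b`-th
exceptional cell, an affine space of dimension `n - (b + 1)`. -/
lemma cls_restrict_blowUpFiltration (h : IsBlowUp π.left (idealOfPoints p))
    (hp : Function.Injective p) (c : ∀ i, PointChart n (p i)) (i : Fin N) (b : ℕ) (hb : b ≤ n) :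
    K0Var.cls (X.restrict (h.blowUpFiltration c i b)) =
      ∑ a ∈ Finset.range b, lefschetz k ^ (n - (a + 1)) +
        K0Var.cls (X.restrict (π.left ⁻¹ᵁ awayFromGe p i)) := by
  induction b with
  | zero =>
    have : h.blowUpFiltration c i 0 = π.left ⁻¹ᵁ awayFromGe p i := by
      ext x
      rw [SetLike.mem_coe, SetLike.mem_coe, mem_blowUpFiltration]
      simp
    rw [this, Finset.range_zero, Finset.sum_empty, zero_add]
  | succ b ih =>
    let a : Fin n := ⟨b, hb⟩
    let H := h.isLocalBlowUp_overChart c i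
    let hV := originPoint_mem_chartDomain hp c i
    let U := π.left ⁻¹ᵁ centreCover c (some i)
    let e : (cell k n (b + 1)).toOver ⟶ X.toOver := Over.homMk (H.exceptionalCell hV a ≫ U.ι) (by
      rw [Category.assoc, ← overChart_comp_specMap_C]
      exact H.exceptionalCell_comp hV a)
    have : IsPreimmersion e.left :=
      inferInstanceAs (IsPreimmersion (H.exceptionalCell hV a ≫ U.ι))
    have hle : h.blowUpFiltration c i b ≤ h.blowUpFiltration c i (b + 1) := fun x hx ↦
      mem_blowUpFiltration.mpr ((mem_blowUpFiltration.mp hx).imp_right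
        fun ⟨a, ha, hx⟩ ↦ ⟨a, ha.trans (Nat.lt_succ_self b), hx⟩)
    rw [K0Var.cls_restrict_eq_add X (cell k n (b + 1)) hle e, ih (by omega), cls_cell, card_fin_ge,
      Finset.sum_range_succ]
    · ring
    change Set.range (H.exceptionalCell hV a ≫ U.ι) = _
    have hU (x : U.toScheme) : π.left (U.ι x) ∈ centreCover c (some i) := x.2
    ext x
    rw [Set.mem_sdiff, SetLike.mem_coe, SetLike.mem_coe, mem_blowUpFiltration,
      mem_blowUpFiltration]
    constructor
    · rintro ⟨z, rfl⟩
      rw [Scheme.Hom.comp_apply]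
      obtain ⟨h₁, h₂, h₃⟩ := (H.mem_range_exceptionalCell_iff hV a _).mp ⟨z, rfl⟩
      refine ⟨Or.inr ⟨a, Nat.lt_succ_self b, ?_⟩, ?_⟩
      · exact (h.mem_range_localChart_iff c i a _).mpr h₂
      · rintro (hx | ⟨l, hl, hx⟩)
        · exact (mem_awayFromGe_iff_of_mem_centreCover c (hU _)).mp hx
            ((overChart_eq_originPoint_iff c i _).mp h₁)
        · exact h₃ l hl ((h.mem_range_localChart_iff c i l _).mp hx)
    · rintro ⟨hx, hx'⟩
      push Not at hx'
      obtain hx | ⟨l, hl, hx⟩ := hx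
      · exact absurd hx hx'.1
      obtain rfl : l = a := by
        by_contra hne
        have : (l : ℕ) ≠ b := fun e ↦ hne (Fin.ext e)
        exact hx'.2 l (by omega) hx
      obtain ⟨y, rfl⟩ := hx
      obtain ⟨w, hw⟩ : ∃ w, w = H.chart a y := ⟨_, rfl⟩
      have hwx : h.localChart c i a y = U.ι w := by
        rw [hw, localChart, Scheme.Hom.comp_apply]
      rw [hwx] at hx' ⊢
      obtain ⟨z, hz⟩ := (H.mem_range_exceptionalCell_iff hV a w).mpr
        ⟨(overChart_eq_originPoint_iff c i w).mpr (not_not.mp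
          (mt (mem_awayFromGe_iff_of_mem_centreCover c (hU w)).mpr hx'.1)),
          ⟨y, hw.symm⟩, fun l hl hx ↦ hx'.2 l hl ((h.mem_range_localChart_iff c i l w).mpr hx)⟩
      exact ⟨z, by rw [Scheme.Hom.comp_apply, hz]⟩

/-- The charts around the `i`-th point cover its fibre, so adding all of them puts back exactly that
fibre and allows induction over the points. -/
lemma blowUpFiltration_eq (h : IsBlowUp π.left (idealOfPoints p)) (hp : Function.Injective p)
    (c : ∀ i, PointChart n (p i)) (i : Fin N) :
    h.blowUpFiltration c i n = π.left ⁻¹ᵁ awayFromGe p (i + 1) := by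
  ext x
  rw [SetLike.mem_coe, SetLike.mem_coe, mem_blowUpFiltration]
  refine ⟨?_, fun hx ↦ or_iff_not_imp_left.mpr fun hx' ↦ ?_⟩
  · rintro (hx | ⟨a, -, y, rfl⟩)
    · have : π.left x ∈ awayFromGe p (i + 1) := awayFromGe_le (p := p) i hx
      exact this
    · have hy : π.left (h.localChart c i a y) ∈ centreCover c (some i) := by
        rw [localChart, Scheme.Hom.comp_apply]
        exact ((h.isLocalBlowUp_overChart c i).chart a y).2
      change π.left (h.localChart c i a y) ∈ awayFromGe p (i + 1)
      refine mem_awayFromGe.mpr fun j hj ↦ ne_pointImage_of_mem_centreCover c (fun e ↦ ?_) hy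
      rw [e] at hj
      exact Nat.not_succ_le_self _ hj
  · have hx1 : π.left x ∈ awayFromGe p (i + 1) := hx
    have hxi := eq_pointImage_of_mem_of_notMem hx1 hx'
    obtain ⟨w, rfl⟩ : x ∈ Set.range (π.left ⁻¹ᵁ centreCover c (some i)).ι := by
      rw [Scheme.Opens.range_ι]
      change π.left x ∈ centreCover c (some i)
      rw [hxi]
      exact pointImage_mem_centreCover hp c i
    obtain ⟨a, ha⟩ := (h.isLocalBlowUp_overChart c i).exists_mem_range_chart w
    exact ⟨a, a.2, (h.mem_range_localChart_iff c i a w).mpr ha⟩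

lemma cls_restrict_preimage_awayFromGe (h : IsBlowUp π.left (idealOfPoints p))
    (hp : Function.Injective p) (c : ∀ i, PointChart n (p i)) (m : ℕ) (hm : m ≤ N) :
    K0Var.cls (X.restrict (π.left ⁻¹ᵁ awayFromGe p m)) =
      m * ∑ a ∈ Finset.range n, lefschetz k ^ (n - (a + 1)) +
        K0Var.cls (X.restrict (π.left ⁻¹ᵁ awayFrom p Set.univ)) := by
  induction m with
  | zero => rw [awayFromGe_zero, Nat.cast_zero, zero_mul, zero_add]
  | succ m ih =>
    have hi := h.blowUpFiltration_eq hp c ⟨m, hm⟩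
    have hc := h.cls_restrict_blowUpFiltration hp c ⟨m, hm⟩ n le_rfl
    dsimp only at hi hc
    rw [← hi, hc, ih (by omega), Nat.cast_succ]
    ring

lemma cls_restrict_preimage_awayFrom (h : IsBlowUp π.left (idealOfPoints p)) :
    K0Var.cls (X.restrict (π.left ⁻¹ᵁ awayFrom p Set.univ)) =
      K0Var.cls (Y.restrict (awayFrom p Set.univ)) := by
  have := h.isIso_morphismRestrict_awayFrom
  let e : (π.left ⁻¹ᵁ awayFrom p Set.univ).toScheme ≅ (awayFrom p Set.univ).toScheme :=
    asIso (π.left ∣_ awayFrom p Set.univ)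
  refine K0Var.cls_eq_of_iso (Over.isoMk e ?_)
  change π.left ∣_ awayFrom p Set.univ ≫ (awayFrom p Set.univ).ι ≫ Y.toOver.hom =
    (π.left ⁻¹ᵁ awayFrom p Set.univ).ι ≫ X.toOver.hom
  rw [morphismRestrict_ι_assoc, Over.w]

/-- The class of the blow-up of an `n`-dimensional variety in `N` rational points: each point is
replaced by a projective space of dimension `n - 1`. -/
theorem cls_add_eq (h : IsBlowUp π.left (idealOfPoints p)) (hp : Function.Injective p)
    (c : ∀ i, PointChart n (p i)) :
    K0Var.cls X + N =
      K0Var.cls Y + N * ∑ a ∈ Finset.range n, lefschetz k ^ (n - (a + 1)) := by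
  -- `X` and `Y` are both built up from the same open complement of the points: `X` gains `N`
  -- exceptional fibres, `Y` gains `N` points. Eliminating the class of the complement gives the
  -- formula.
  have hX := h.cls_restrict_preimage_awayFromGe hp c N le_rfl
  have hY := cls_restrict_awayFromGe (Y := Y) (p := p) (fun i j e ↦ by
    by_contra hij
    exact pointImage_ne hp c hij e) N le_rfl
  rw [awayFromGe_eq_top] at hX hY
  have hX' : K0Var.cls (X.restrict (π.left ⁻¹ᵁ ⊤)) = K0Var.cls X := K0Var.cls_restrict_top X
  rw [hX', h.cls_restrict_preimage_awayFrom] at hX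
  rw [K0Var.cls_restrict_top] at hY
  rw [hX, hY]
  ring

end IsBlowUp

/-- The blow-up of projective 3-space in eight rational points. -/
lemma exists_isVariety_cls_eq {p : Fin 8 → RationalPoint (projectiveThreeSpace k)}
    (hp : Function.Injective p) {X : Over (Spec (.of k))} {π : X ⟶ projectiveThreeSpace k}
    (h : IsBlowUp π.left (idealOfPoints p)) : ∃ hX : IsVariety X,
      K0Var.cls ⟨X, hX⟩ = lefschetz k ^ 3 + 9 * lefschetz k ^ 2 + 9 * lefschetz k + 1 := by
  change Fin 8 → RationalPoint (projSpace k 3).toOver at p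
  change X ⟶ (projSpace k 3).toOver at π
  have c (i) : PointChart 3 (p i) := (nonempty_pointChart (p i)).some
  have hX : IsVariety X := h.isVariety_of_pointCharts hp c
  have hc := IsBlowUp.cls_add_eq (X := ⟨X, hX⟩) h hp c
  refine ⟨hX, add_right_cancel (hc.trans ?_)⟩
  -- It remains to check `(𝕃³ + 𝕃² + 𝕃 + 1) + 8(𝕃² + 𝕃 + 1) = (𝕃³ + 9𝕃² + 9𝕃 + 1) + 8`, where the
  -- last `8` accounts for the removed points.
  rw [cls_projSpace]
  simp only [Finset.sum_range_succ, Finset.range_zero, Finset.sum_empty]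
  norm_num
  ring

theorem mainTheorem1 (k : Type u) [Field k] [CharZero k] :
    -- the class of the blow-up at 8 distinct points is given by a formula without `p`
    (∀ (p : Fin 8 → RationalPoint (projectiveThreeSpace k)) (_ : Function.Injective p)
        (X : Over (Spec (.of k))) (π : X ⟶ projectiveThreeSpace k)
        (_ : IsBlowUp π.left (idealOfPoints p)),
      ∃ hX : IsVariety X,
        K0Var.cls ⟨X, hX⟩ = lefschetz k ^ 3 + 9 * lefschetz k ^ 2 + 9 * lefschetz k + 1) ∧
    -- any two such blow-ups have the same class and are L-equivalent
    (∀ (p q : Fin 8 → RationalPoint (projectiveThreeSpace k))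
        (_ : Function.Injective p) (_ : Function.Injective q)
        (X Y : Over (Spec (.of k)))
        (π : X ⟶ projectiveThreeSpace k) (ρ : Y ⟶ projectiveThreeSpace k)
        (_ : IsBlowUp π.left (idealOfPoints p)) (_ : IsBlowUp ρ.left (idealOfPoints q)),
      ∃ (hX : IsVariety X) (hY : IsVariety Y),
        K0Var.cls ⟨X, hX⟩ = K0Var.cls ⟨Y, hY⟩ ∧ LEquivalent ⟨X, hX⟩ ⟨Y, hY⟩) := by
  refine ⟨fun p hp X π h ↦ exists_isVariety_cls_eq hp h, fun p q hp hq X Y π ρ h h' ↦ ?_⟩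
  obtain ⟨hX, eX⟩ := exists_isVariety_cls_eq hp h
  obtain ⟨hY, eY⟩ := exists_isVariety_cls_eq hq h'
  have e := eX.trans eY.symm
  -- The classes agree already before inverting `𝕃`, so their difference maps to zero.
  exact ⟨hX, hY, e, by rw [LEquivalent, e, sub_self, map_zero]⟩

end
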